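/- Let $\Gamma$ be a finite simple graph with totally ordered vertex set $V=\{v_1<\dots<v_r\}$, and let $M$ be its trace monoid, i.e. the monoid generated by $V$ subject to $v_iv_j=v_jv_i$ for every edge $\{v_i,v_j\}$ of $\Gamma$. Write $|m|$ for the length of any word representing $m\in M$. Let $U=\mathbb{Z}[M]$ be the monoid ring, with Lie bracket $[a,b]=ab-ba$, let $U_n$ be the span of the elements $m\in M$ with $|m|=n$, and let $L_\Gamma$ be the Lie subring of $U$ generated by $v_1,\dots,v_r$. For $m\in M$ let $\mathrm{std}(m)$ be the lexicographically largest word representing $m$ (a proper prefix of a word is smaller than the word), and order $M$ by $a<b \iff \mathrm{std}(a)<\mathrm{std}(b)$. Elements of $M$ are conjugate if they are joined by a finite sequence of transpositions $xy\mapsto yx$ $(x,y\in M)$. An element $m\in M$ is a Lyndon element if $m\neq 1$, $m$ is not of the form $m=xy=yx$ with $x,y\ne 1$, and $m$ is minimal in its conjugacy class. Let $LE(M)$ be the set of Lyndon elements. The standard factorisation $S(m)=(x,y)$ of a Lyndon element $m$ with $|m|>1$ is the pair of Lyndon elements with $m=xy$ for which $y$ is minimal among all such pairs. Let $\ell:\mathbb{Z}[LE(M)]\to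 L_\Gamma$ be the homomorphism from the free $\mathbb{Z}$-module on $LE(M)$ given recursively by $\ell(v_i)=v_i$ and $\ell(m)=[\ell(x),\ell(y)]$ if $|m|>1$ and $S(m)=(x,y)$. Then $\ell$ is a bijection. Hence the bracketed Lyndon elements $\ell(a)$, $a\in LE(M)$, form a $\mathbb{Z}$-basis of $L_\Gamma$; and for every $n\ge 0$ there are only finitely many Lyndon elements of length $n$, and the elements $\ell(a)$ with $a\in LE(M)$, $|a|=n$, form a $\mathbb{Z}$-basis of the degree-$n$ part $L_\Gamma\cap U_n$ of $L_\Gamma$. -/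

import Mathlib

/-- The defining relations `vᵢ vⱼ = vⱼ vᵢ` of the trace monoid of `Γ`, one for each edge of `Γ`. -/
def TraceRel {V : Type*} (Γ : SimpleGraph V) (w w' : FreeMonoid V) : Prop :=
  ∃ i j : V, Γ.Adj i j ∧ w = FreeMonoid.of i * FreeMonoid.of j ∧
    w' = FreeMonoid.of j * FreeMonoid.of i

/-- The trace monoid (free partially commutative monoid) `M` of the graph `Γ`: words in the
vertices of `Γ`, up to exchanging neighbouring letters that are adjacent in `Γ`. -/
def TraceMonoid {V : Type*} (Γ : SimpleGraph V) : Type _ := PresentedMonoid (TraceRel Γ)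

namespace TraceMonoid

noncomputable section

variable {V : Type*} (Γ : SimpleGraph V)

instance instMonoid : Monoid (TraceMonoid Γ) :=
  inferInstanceAs (Monoid (PresentedMonoid (TraceRel Γ)))

/-- The generator of `M` given by a vertex. -/
def of (i : V) : TraceMonoid Γ := PresentedMonoid.of (TraceRel Γ) i

/-- The projection `π` from words to elements of `M`, as a monoid homomorphism. -/
def projHom : FreeMonoid V →* TraceMonoid Γ := PresentedMonoid.mk (TraceRel Γ)

/-- The projection `π` from words to elements of `M`. -/
def proj (w : List V) : TraceMonoid Γ := projHom Γ (FreeMonoid.ofList w)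

theorem proj_surjective : Function.Surjective (proj Γ) := fun m => by
  obtain ⟨w, hw⟩ := PresentedMonoid.surjective_mk (rels := TraceRel Γ) m
  exact ⟨FreeMonoid.toList w, hw⟩

/-- The length homomorphism from `M` to `ℕ`, written multiplicatively. -/
def lengthHom : TraceMonoid Γ →* Multiplicative ℕ :=
  PresentedMonoid.lift (rels := TraceRel Γ) (fun _ => Multiplicative.ofAdd 1) (by
    rintro a b ⟨i, j, -, rfl, rfl⟩
    simp)

variable {Γ}

/-- The length `|m|`, i.e. the length of any word representing `m`. -/
def length (m : TraceMonoid Γ) : ℕ := Multiplicative.toAdd (lengthHom Γ m)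

theorem length_mul (a b : TraceMonoid Γ) : (a * b).length = a.length + b.length := by
  simp [length]

theorem length_proj (w : List V) : (proj Γ w).length = w.length := by
  have h : ∀ u : FreeMonoid V, lengthHom Γ (projHom Γ u) = Multiplicative.ofAdd u.length := by
    intro u
    induction u using FreeMonoid.inductionOn' with
    | one => simp
    | of_mul x xs ih =>
      rw [map_mul, map_mul, ih, FreeMonoid.length_mul, ofAdd_add, FreeMonoid.length_of]
      rfl
  exact congrArg Multiplicative.toAdd (h (FreeMonoid.ofList w))

theorem length_pos {m : TraceMonoid Γ} (hm : m ≠ 1) : 0 < m.length := by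
  obtain ⟨w, rfl⟩ := proj_surjective Γ m
  rw [length_proj, List.length_pos_iff]
  rintro rfl
  exact hm rfl

theorem finite_fiber [Finite V] (m : TraceMonoid Γ) : {w : List V | proj Γ w = m}.Finite :=
  (List.finite_length_eq V m.length).subset fun w hw => by
    rw [← show proj Γ w = m from hw, length_proj]; rfl

theorem exists_isGreatest_fiber [LinearOrder V] [Finite V] (m : TraceMonoid Γ) :
    ∃ w, IsGreatest {w : List V | proj Γ w = m} w := by
  obtain ⟨w, hw, hmax⟩ := Set.exists_max_image _ id (finite_fiber m) (proj_surjective Γ m)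
  exact ⟨w, hw, hmax⟩

/-- The standard representative of `m`: the largest word representing `m`, in the lexicographic
order on words (in which a proper prefix of a word is smaller than the word). -/
def std [LinearOrder V] [Finite V] (m : TraceMonoid Γ) : List V :=
  (exists_isGreatest_fiber m).choose

theorem proj_std [LinearOrder V] [Finite V] (m : TraceMonoid Γ) : proj Γ (std m) = m :=
  (exists_isGreatest_fiber m).choose_spec.1

theorem std_injective [LinearOrder V] [Finite V] :
    Function.Injective (std : TraceMonoid Γ → List V) :=
  Function.LeftInverse.injective proj_std

/-- The total order on `M`: `a < b` if and only if `std a < std b`. -/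
instance instLinearOrder [LinearOrder V] [Finite V] : LinearOrder (TraceMonoid Γ) :=
  LinearOrder.lift' std std_injective

/-- `a` and `b` are transposed: `a = xy` and `b = yx` for some `x`, `y`. -/
def Transposed (a b : TraceMonoid Γ) : Prop := ∃ x y, a = x * y ∧ b = y * x

/-- `a` and `b` are conjugate: `b` is obtained from `a` by a finite sequence of
transpositions. -/
def Conjugate (a b : TraceMonoid Γ) : Prop := Relation.ReflTransGen Transposed a b

/-- `m` is primitive: it is not of the form `xy = yx` with `x`, `y` nontrivial. -/
def Primitive (m : TraceMonoid Γ) : Prop :=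
  ¬ ∃ x y : TraceMonoid Γ, x ≠ 1 ∧ y ≠ 1 ∧ m = x * y ∧ m = y * x

section Lyndon

variable [LinearOrder V] [Finite V]

/-- Lyndon elements of `M`: nontrivial, primitive, and minimal in their conjugacy class. -/
structure IsLyndon (m : TraceMonoid Γ) : Prop where
  ne_one : m ≠ 1
  primitive : Primitive m
  le_of_conjugate : ∀ m', Conjugate m m' → m ≤ m'

/-- `S(m) = (x, y)` is the standard factorisation of `m`: among all pairs of Lyndon elements
with product `m`, the second entry `y` is minimal. -/
structure IsStandardFactorisation (m x y : TraceMonoid Γ) : Prop where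
  left : IsLyndon x
  right : IsLyndon y
  mul_eq : x * y = m
  le : ∀ x' y', IsLyndon x' → IsLyndon y' → x' * y' = m → y ≤ y'

variable (Γ) in
/-- The set `LE(M)` of Lyndon elements, as a type. -/
abbrev LyndonElement : Type _ := {m : TraceMonoid Γ // IsLyndon m}

open Classical in
/-- The bracketing of a Lyndon element, evaluated in a Lie ring at a family `x` of elements:
a generator `vᵢ` goes to `x i`, and `m` with `|m| > 1` and `S(m) = (a, b)` goes to the bracket of
the values at `a` and `b`. (The value `0` is given to elements of `M` which are neither
generators nor have a standard factorisation; no Lyndon element is of this kind.) -/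
def bracketing {L : Type*} [LieRing L] (x : V → L) (m : TraceMonoid Γ) : L :=
  if h₁ : ∃ i, m = of Γ i then x h₁.choose
  else if h₂ : ∃ p : TraceMonoid Γ × TraceMonoid Γ, IsStandardFactorisation m p.1 p.2 then
    ⁅bracketing x h₂.choose.1, bracketing x h₂.choose.2⁆
  else 0
termination_by m.length
decreasing_by
  · have h := h₂.choose_spec
    have e := congrArg length h.mul_eq
    rw [length_mul] at e
    have := length_pos h.right.ne_one
    omega
  · have h := h₂.choose_spec
    have e := congrArg length h.mul_eq
    rw [length_mul] at e
    have := length_pos h.left.ne_one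
    omega

/-- The `ℤ`-linear map `φ_X : ℤ[LE(M)] → L` induced by the bracketing and a family `x` of
elements of the Lie algebra `L`. -/
def phi {L : Type*} [LieRing L] [LieAlgebra ℤ L] (x : V → L) :
    (LyndonElement Γ →₀ ℤ) →ₗ[ℤ] L :=
  Finsupp.linearCombination ℤ fun a : LyndonElement Γ => bracketing x a.1

end Lyndon

variable (Γ)

/-- The algebra `U`: the free `ℤ`-module on `M`, with the multiplication of `M`. -/
abbrev U : Type _ := MonoidAlgebra ℤ (TraceMonoid Γ)

/-- The Lie bracket of `U` is the commutator `ab - ba`. -/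
instance instLieRingU : LieRing (U Γ) := LieRing.ofAssociativeRing

instance instLieAlgebraU : LieAlgebra ℤ (U Γ) :=
  letI : LieRing (U Γ) := LieRing.ofAssociativeRing
  LieAlgebra.ofAssociativeAlgebra

/-- The homogeneous component of degree `n` of `U`, spanned by the elements of `M` of
length `n`. -/
def gradedU (n : ℕ) : Submodule ℤ (U Γ) :=
  Submodule.span ℤ (MonoidAlgebra.of ℤ (TraceMonoid Γ) '' {m | m.length = n})

/-- The vertex `vᵢ` as an element of `U`. -/
def vertexU (i : V) : U Γ := MonoidAlgebra.of ℤ (TraceMonoid Γ) (of Γ i)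

/-- The Lie subalgebra `L_Γ` of `U` generated by the vertices. -/
def lieAlg : LieSubalgebra ℤ (U Γ) := LieSubalgebra.lieSpan ℤ (U Γ) (Set.range (vertexU Γ))

/-- The homogeneous component of degree `n` of `L_Γ`, that is `L_Γ ∩ Uₙ`. -/
def gradedLieAlg (n : ℕ) : Submodule ℤ (U Γ) := (lieAlg Γ).toSubmodule ⊓ gradedU Γ n

/-- The vertex `vᵢ` as an element of `L_Γ`. -/
def vertexL (i : V) : lieAlg Γ :=
  ⟨vertexU Γ i, LieSubalgebra.subset_lieSpan (Set.mem_range_self i)⟩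

/-- The bracketing map `ℓ = φ_V : ℤ[LE(M)] → L_Γ`. -/
def ell [LinearOrder V] [Finite V] : (LyndonElement Γ →₀ ℤ) →ₗ[ℤ] lieAlg Γ :=
  phi (vertexL Γ)

end

end TraceMonoid

/-! The proof first reduces Lyndon elements to Lyndon words: `m` is a Lyndon element if and only if
`std m` is a Lyndon word (`isLyndon_iff`), and the standard factorisation of `m` cuts `std m` in
two. The engine is `std_mul_of_rooted`, which says when standard words concatenate. It turns the
unique factorisation of words into decreasing products of Lyndon words into the same statement for
`M` (`exists_pairwise_prod_eq`, `eq_of_pairwise_prod_eq`).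

By induction on the standard factorisation, the bracketing of a Lyndon element `m` is `m` plus
larger elements of the same length (`IsLyndon.hasLeading`). Hence a decreasing product of
bracketings has the product of the Lyndon elements as its leading term. Each element of `M` occurs
exactly once as such a leading term, so these products form a `ℤ`-basis of `U` (`sortedBasis`),
indexed by multisets of Lyndon elements. In particular the bracketings are linearly independent.

That they span `L_Γ` is shown without rewriting brackets of bracketings. For the coproduct of `U`
with primitive vertices, every element of `L_Γ` is primitive. Contracting the coproduct with the
coordinate of a Lyndon element `y` acts on the sorted basis as the partial derivative by `y` acts on
monomials (`contract_coproduct_sortedProd`). For a primitive element all these derivatives are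
constants, so, `ℤ` being torsion-free, only coordinates at one-element multisets survive
(`coord_eq_zero_of_mem_lieAlg`). The bracketings are homogeneous, which gives the graded statement.
-/

namespace List

/-! ### Lexicographic order, Lyndon words and their factorisations. -/

variable {α : Type*} [LinearOrder α]

/-- The strict lexicographic order on words, as part of their linear order. -/
instance instLTLex : LT (List α) := Preorder.toLT

theorem cons_lt_cons_iff_lex {a b : α} {u v : List α} :
    a :: u < b :: v ↔ a < b ∨ a = b ∧ u < v :=
  List.cons_lt_cons_iff

theorem cons_le_cons_iff_lex {a b : α} {u v : List α} :
    a :: u ≤ b :: v ↔ a < b ∨ a = b ∧ u ≤ v := by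
  rw [← not_lt, cons_lt_cons_iff_lex, ← not_lt (a := v)]
  rcases lt_trichotomy a b with h | h | h
  · simp [h, h.not_gt, h.ne']
  · simp [h]
  · simp [h, h.not_gt, h.ne']

theorem nil_lt_cons_lex (a : α) (u : List α) : [] < a :: u := List.Lex.nil

theorem nil_le_lex (u : List α) : [] ≤ u := by
  cases u with
  | nil => exact le_rfl
  | cons a u => exact (nil_lt_cons_lex a u).le

theorem not_lt_nil_lex (u : List α) : ¬ u < [] := (nil_le_lex u).not_gt

theorem append_lt_append_left_iff (u : List α) {v w : List α} : u ++ v < u ++ w ↔ v < w := by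
  induction u with
  | nil => rfl
  | cons a u ih => simp [ih]

theorem append_le_append_left_iff (u : List α) {v w : List α} : u ++ v ≤ u ++ w ↔ v ≤ w := by
  rw [← not_lt, append_lt_append_left_iff, not_lt]

theorem le_append_lex (u v : List α) : u ≤ u ++ v := by
  conv_lhs => rw [← List.append_nil u]
  exact (append_le_append_left_iff u).2 (nil_le_lex v)

/-- If `u < v` then `u` is a prefix of `v`, or `u` and `v` differ at a first position. -/
theorem lt_cases_lex {u v : List α} (h : u < v) :
    (∃ c, c ≠ [] ∧ v = u ++ c) ∨ ∀ d e, u ++ d < v ++ e := by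
  induction u generalizing v with
  | nil => exact Or.inl ⟨v, by rintro rfl; exact lt_irrefl _ h, rfl⟩
  | cons a u ih =>
    cases v with
    | nil => exact absurd h (not_lt_nil_lex _)
    | cons b v =>
      rcases cons_lt_cons_iff_lex.1 h with h1 | ⟨rfl, h1⟩
      · exact Or.inr fun d e => cons_lt_cons_iff_lex.2 (Or.inl h1)
      · rcases ih h1 with ⟨c, hc, rfl⟩ | h
        · exact Or.inl ⟨c, hc, rfl⟩
        · exact Or.inr fun d e => cons_lt_cons_iff_lex.2 (Or.inr ⟨rfl, h d e⟩)

/-- The length condition excludes that `u` is a proper prefix of `v`, so the two words differ at a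
position that no continuation affects. -/
theorem append_lt_append_of_lt {u v : List α} (h : u < v) (hl : v.length ≤ u.length)
    (d e : List α) : u ++ d < v ++ e := by
  rcases lt_cases_lex h with ⟨c, hc, rfl⟩ | h
  · have := List.length_pos_iff.2 hc
    simp only [List.length_append] at hl
    omega
  · exact h d e

theorem append_le_append_of_le {u v d e : List α} (h : u ≤ v) (hl : v.length ≤ u.length)
    (hd : d ≤ e) : u ++ d ≤ v ++ e := by
  rcases h.eq_or_lt with rfl | h
  · exact (append_le_append_left_iff u).2 hd
  · exact (append_lt_append_of_lt h hl d e).le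

theorem le_of_append_le_append {u v d e : List α} (h : u ++ d ≤ v ++ e)
    (hl : u.length ≤ v.length) : u ≤ v := by
  by_contra h'
  exact absurd (append_lt_append_of_lt (not_le.1 h') hl e d) h.not_gt

/-- A Lyndon word is a nonempty word smaller than all its proper nonempty suffixes. -/
structure IsLyndonWord (w : List α) : Prop where
  ne_nil : w ≠ []
  lt_suffix : ∀ u v, u ≠ [] → v ≠ [] → w = u ++ v → w < v

theorem IsLyndonWord.le_suffix {w u v : List α} (h : IsLyndonWord w) (hv : v ≠ [])
    (e : w = u ++ v) : w ≤ v := by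
  rcases eq_or_ne u [] with rfl | hu
  · simp [e]
  · exact (h.lt_suffix u v hu hv e).le

theorem IsLyndonWord.lt_rotation {w u v : List α} (h : IsLyndonWord w) (hu : u ≠ [])
    (hv : v ≠ []) (e : w = u ++ v) : w < v ++ u :=
  (h.lt_suffix u v hu hv e).trans_le (le_append_lex v u)

theorem IsLyndonWord.head_le {a : α} {w : List α} (h : IsLyndonWord (a :: w)) {b : α}
    (hb : b ∈ a :: w) : a ≤ b := by
  obtain ⟨s, t, e⟩ := List.append_of_mem hb
  rcases cons_le_cons_iff_lex.1 (h.le_suffix (by simp) e) with h | h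
  exacts [h.le, h.1.le]

/-- A word which is strictly smaller than all its proper rotations is a Lyndon word. -/
theorem isLyndonWord_of_lt_rotation {w : List α} (hw : w ≠ [])
    (h : ∀ u v, u ≠ [] → v ≠ [] → w = u ++ v → w < v ++ u) : IsLyndonWord w := by
  refine ⟨hw, fun u v hu hv e => ?_⟩
  by_contra hlt
  have hrot := h u v hu hv e
  have hul := List.length_pos_iff.2 hu
  have hlen : w.length = u.length + v.length := by rw [e, List.length_append]
  rcases (not_lt.1 hlt).eq_or_lt with h1 | h1
  · rw [h1] at hlen; omega
  rcases lt_cases_lex h1 with ⟨c, hc, hc'⟩ | h2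
  -- Here `w = uv = vc`. The rotation `vu` gives `c < u`, hence `cv < uv = w` because the lengths
  -- agree, whereas the rotation `cv` must exceed `w`.
  · have h3 := h v c hv hc hc'
    rw [hc', append_lt_append_left_iff] at hrot
    rw [e] at h3
    have hcl : c.length = u.length := by
      rw [hc', List.length_append] at hlen
      omega
    exact absurd (append_lt_append_of_lt hrot hcl.ge v v) h3.not_gt
  · exact absurd (by simpa using h2 u []) hrot.not_gt

/-- Among the nonempty suffixes of `v` preceded by a word, there is a smallest one. -/
theorem exists_minimal_suffix (u : List α) {v : List α} (hv : v ≠ []) :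
    ∃ l r, r ≠ [] ∧ u ++ v = l ++ r ∧ r.length ≤ v.length ∧
      ∀ l' r', r' ≠ [] → u ++ v = l' ++ r' → r'.length ≤ v.length → r ≤ r' := by
  have hfin : {r : List α | r ≠ [] ∧ r.length ≤ v.length ∧ ∃ l, u ++ v = l ++ r}.Finite := by
    refine (List.finite_toSet (u ++ v).tails).subset ?_
    rintro r ⟨-, -, l, e⟩
    simp only [Set.mem_ofPred_eq, List.mem_tails]
    exact ⟨l, e.symm⟩
  obtain ⟨r, ⟨hr, hl, l, e⟩, hmin⟩ := Set.exists_min_image _ id hfin ⟨v, hv, le_rfl, u, rfl⟩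
  exact ⟨l, r, hr, e, hl, fun l' r' hr' e' hl' => hmin r' ⟨hr', hl', l', e'⟩⟩

/-- A nonempty word which is at most all its nonempty suffixes is a Lyndon word. -/
theorem isLyndonWord_of_le_suffix {w : List α} (hw : w ≠ [])
    (h : ∀ u v, v ≠ [] → w = u ++ v → w ≤ v) : IsLyndonWord w := by
  refine ⟨hw, fun u v hu hv e => (h u v hv e).lt_of_ne ?_⟩
  rintro rfl
  exact hu (by simpa using e)

/-- The standard factorisation of a Lyndon word. -/
theorem IsLyndonWord.exists_factorisation {w : List α} (hw : IsLyndonWord w)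
    (hl : 1 < w.length) :
    ∃ l r, IsLyndonWord l ∧ IsLyndonWord r ∧ w = l ++ r ∧
      ∀ l' r', l' ≠ [] → r' ≠ [] → w = l' ++ r' → r ≤ r' := by
  obtain ⟨a, v, rfl⟩ := List.exists_cons_of_ne_nil hw.ne_nil
  have hv : v ≠ [] := by rintro rfl; simp at hl
  obtain ⟨l, r, hr, e, hrl, hmin⟩ := exists_minimal_suffix [a] hv
  rw [List.singleton_append] at e
  have hmin' : ∀ l' r', l' ≠ [] → r' ≠ [] → a :: v = l' ++ r' → r ≤ r' := by
    intro l' r' hl' hr' e'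
    refine hmin l' r' hr' e' ?_
    have := congrArg List.length e'
    have h1 := List.length_pos_iff.2 hl'
    simp only [List.length_append, List.length_cons] at this
    omega
  have hlne : l ≠ [] := by
    rintro rfl
    have := congrArg List.length e
    simp only [List.length_append, List.length_cons, List.length_nil] at this
    omega
  refine ⟨l, r, isLyndonWord_of_le_suffix hlne ?_, isLyndonWord_of_le_suffix hr ?_, e, hmin'⟩
  · rintro q p hp rfl
    by_contra hlt
    -- A suffix `p` of `l` below `l` is impossible. If `l = pz`, then `w < pr` gives `zr < r`,
    -- against the minimality of `r`. Otherwise `p` and `l` differ at a letter, so the suffix `pr`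
    -- of `w` is below `lr = w`.
    rcases lt_cases_lex (not_le.1 hlt) with ⟨z, hz, hz'⟩ | h
    · have h1 := hw.lt_suffix z (z ++ r) hz (by simp [hz])
      have hq : q ≠ [] := by
        rintro rfl
        exact hz (by simpa using hz')
      have h2 : a :: v < p ++ r := hw.lt_suffix q (p ++ r) hq (by simp [hp]) (by simp [e])
      have h3 : a :: v = p ++ (z ++ r) := by rw [e, hz', List.append_assoc]
      rw [h3, append_lt_append_left_iff] at h2
      exact absurd (hmin' p (z ++ r) hp (by simp [hz]) h3) h2.not_ge
    · have h2 := hw.le_suffix (u := q) (v := p ++ r) (by simp [hp]) (by simp [e])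
      rw [e] at h2
      exact absurd (h r r) h2.not_gt
  · rintro q p hp rfl
    exact hmin' (l ++ q) p (by simp [hlne]) hp (by simp [e])

theorem IsLyndonWord.append {u v : List α} (hu : IsLyndonWord u) (hv : IsLyndonWord v)
    (h : u < v) : u ++ v < v := by
  rcases lt_cases_lex h with ⟨c, hc, rfl⟩ | h
  · exact (append_lt_append_left_iff u).2 (hv.lt_suffix u c hu.ne_nil hc rfl)
  · simpa using h v []

/-- Every word is a weakly decreasing product of Lyndon words. -/
theorem exists_lyndon_factorisation (w : List α) :
    ∃ L : List (List α), (∀ l ∈ L, IsLyndonWord l) ∧ L.Pairwise (· ≥ ·) ∧ L.flatten = w := by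
  induction hn : w.length using Nat.strong_induction_on generalizing w with
  | _ n ih =>
    rcases eq_or_ne w [] with rfl | hw
    · exact ⟨[], by simp, by simp, rfl⟩
    obtain ⟨l, r, hr, e, -, hmin⟩ := exists_minimal_suffix [] hw
    have hrl := List.length_pos_iff.2 hr
    rw [List.nil_append] at e
    have hmin' : ∀ l' r', r' ≠ [] → w = l' ++ r' → r ≤ r' := fun l' r' hr' e' =>
      hmin l' r' hr' e' (by rw [e']; simp)
    have hrL : IsLyndonWord r := isLyndonWord_of_le_suffix hr fun q p hp e' =>
      hmin' (l ++ q) p hp (by rw [e, e', List.append_assoc])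
    obtain ⟨L, hL, hs, hf⟩ := ih l.length (by rw [← hn, e]; simp; omega) l rfl
    refine ⟨L ++ [r], ?_, ?_, by simp [hf, e]⟩
    · simp only [List.mem_append, List.mem_singleton]
      rintro x (hx | rfl)
      exacts [hL x hx, hrL]
    · refine List.pairwise_append.2 ⟨hs, by simp, fun x hx y hy => ?_⟩
      obtain rfl := List.mem_singleton.1 hy
      rcases List.eq_nil_or_concat' L with rfl | ⟨K, z, rfl⟩
      · simp at hx
      -- If the factor `z` before `y` were smaller, then `zy < y` would be a smaller suffix.
      have hz : y ≤ z := by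
        by_contra hlt
        have h1 := (hL z (by simp)).append hrL (not_le.1 hlt)
        exact absurd (hmin' K.flatten (z ++ y) (by simp [hr]) (by simp [e, ← hf])) h1.not_ge
      rcases List.mem_append.1 hx with hx | hx
      · exact hz.trans ((List.pairwise_append.1 hs).2.2 x hx z (by simp))
      · rwa [List.mem_singleton.1 hx]

/-- The suffix `v` starts inside some factor, and what remains of that factor is at least the factor
itself, since it is Lyndon. -/
theorem le_suffix_of_lyndon_factorisation {L : List (List α)} {r : List α}
    (hL : ∀ l ∈ L, IsLyndonWord l) (hr : ∀ l ∈ L, r ≤ l) {u v : List α} (hv : v ≠ [])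
    (h : L.flatten = u ++ v) : r ≤ v := by
  induction L generalizing u with
  | nil => simp_all
  | cons l L ih =>
    rw [List.flatten_cons, List.append_eq_append_iff] at h
    rcases h with ⟨c, -, h⟩ | ⟨c, rfl, rfl⟩
    · exact ih (fun x hx => hL x (by simp [hx])) (fun x hx => hr x (by simp [hx])) h
    · rcases eq_or_ne c [] with rfl | hc
      · exact ih (u := []) (fun x hx => hL x (by simp [hx])) (fun x hx => hr x (by simp [hx])) rfl
      · exact (hr _ (by simp)).trans
          (((hL (u ++ c) (by simp)).le_suffix hc rfl).trans (le_append_lex _ _))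

/-- The last factor is the smallest nonempty suffix, so the word determines it; the rest follows by
induction. -/
theorem lyndon_factorisation_unique {L L' : List (List α)} (hL : ∀ l ∈ L, IsLyndonWord l)
    (hs : L.Pairwise (· ≥ ·)) (hL' : ∀ l ∈ L', IsLyndonWord l)
    (hs' : L'.Pairwise (· ≥ ·)) (h : L.flatten = L'.flatten) : L = L' := by
  induction L using List.reverseRecOn generalizing L' with
  | nil =>
    cases L' with
    | nil => rfl
    | cons l L' =>
      have := (hL' l (by simp)).ne_nil
      simp_all
  | append_singleton K r ih =>
    have hrne := (hL r (by simp)).ne_nil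
    rcases List.eq_nil_or_concat' L' with rfl | ⟨K', r', rfl⟩
    · simp_all
    have hrne' := (hL' r' (by simp)).ne_nil
    have aux : ∀ (K : List (List α)) (r : List α), (K ++ [r]).Pairwise (· ≥ ·) →
        ∀ l ∈ K ++ [r], r ≤ l := by
      intro K r hs l hl
      rcases List.mem_append.1 hl with hl | hl
      · exact (List.pairwise_append.1 hs).2.2 l hl r (by simp)
      · rw [List.mem_singleton.1 hl]
    have e : r = r' := le_antisymm
      (le_suffix_of_lyndon_factorisation hL (aux K r hs) hrne' (h.trans List.flatten_concat))
      (le_suffix_of_lyndon_factorisation hL' (aux K' r' hs') hrne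
        (h.symm.trans List.flatten_concat))
    subst e
    rw [List.flatten_concat, List.flatten_concat, List.append_left_inj] at h
    rw [ih (fun x hx => hL x (by simp [hx])) (List.pairwise_append.1 hs).1
      (fun x hx => hL' x (by simp [hx])) (List.pairwise_append.1 hs').1 h]

end List

/-! ### Trace monoids: projections to pairs of letters, cancellation, initial letters. -/

namespace TraceMonoid

variable {V : Type*} {Γ : SimpleGraph V}

section Basic

theorem proj_append (u v : List V) : proj Γ (u ++ v) = proj Γ u * proj Γ v := by
  simp [proj, FreeMonoid.ofList_append]

theorem proj_nil : proj Γ [] = 1 := rfl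

theorem proj_singleton (x : V) : proj Γ [x] = of Γ x := rfl

theorem proj_cons (x : V) (v : List V) : proj Γ (x :: v) = of Γ x * proj Γ v :=
  proj_append [x] v

theorem length_of (x : V) : (of Γ x).length = 1 := length_proj [x]

theorem length_one : (1 : TraceMonoid Γ).length = 0 := length_proj []

theorem length_eq_zero {m : TraceMonoid Γ} : m.length = 0 ↔ m = 1 := by
  refine ⟨fun h => ?_, fun h => h ▸ length_one⟩
  by_contra hm
  exact (length_pos hm).ne' h

theorem of_comm {x y : V} (h : Γ.Adj x y) : of Γ x * of Γ y = of Γ y * of Γ x := by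
  have : ConGen.Rel (TraceRel Γ) (FreeMonoid.of x * FreeMonoid.of y)
      (FreeMonoid.of y * FreeMonoid.of x) := .of _ _ ⟨x, y, h, rfl, rfl⟩
  exact (Con.eq _).2 this

/-- The homomorphism out of a trace monoid given by images of the generators. -/
def liftHom {N : Type*} [Monoid N] (f : V → N)
    (hf : ∀ x y, Γ.Adj x y → f x * f y = f y * f x) : TraceMonoid Γ →* N :=
  PresentedMonoid.lift (rels := TraceRel Γ) f (by
    rintro a b ⟨i, j, h, rfl, rfl⟩
    simpa using hf i j h)

theorem liftHom_of {N : Type*} [Monoid N] (f : V → N)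
    (hf : ∀ x y, Γ.Adj x y → f x * f y = f y * f x) (x : V) :
    liftHom (Γ := Γ) f hf (of Γ x) = f x := rfl

theorem induction_on {p : TraceMonoid Γ → Prop} (m : TraceMonoid Γ) (one : p 1)
    (of_mul : ∀ x m, p m → p (of Γ x * m)) : p m := by
  obtain ⟨w, rfl⟩ := proj_surjective Γ m
  induction w with
  | nil => exact one
  | cons x w ih => rw [proj_cons]; exact of_mul x _ ih

/-- The multiset of letters of an element of the trace monoid. -/
def content (m : TraceMonoid Γ) : Multiset V :=
  Multiplicative.toAdd
    (liftHom (Γ := Γ) (fun x => Multiplicative.ofAdd ({x} : Multiset V))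
      (fun _ _ _ => mul_comm _ _) m)

theorem content_mul (a b : TraceMonoid Γ) : content (a * b) = content a + content b := by
  simp [content]

theorem content_one : content (1 : TraceMonoid Γ) = 0 := by simp [content]

theorem content_of (x : V) : content (of Γ x) = {x} := rfl

theorem content_proj (w : List V) : content (proj Γ w) = w := by
  induction w with
  | nil => exact content_one
  | cons x w ih => rw [proj_cons, content_mul, ih, content_of]; simp

/-- The projection to the words in two given letters that do not commute. -/
def pairHom [DecidableEq V] (a b : V) (h : ¬ Γ.Adj a b) : TraceMonoid Γ →* FreeMonoid V :=
  liftHom (fun x => if x = a ∨ x = b then FreeMonoid.of x else 1) (by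
    intro x y hxy
    by_cases hx : x = a ∨ x = b <;> by_cases hy : y = a ∨ y = b <;> simp only [hx, hy, if_true,
      if_false, mul_one, one_mul]
    exfalso
    rcases hx with rfl | rfl <;> rcases hy with rfl | rfl
    exacts [Γ.loopless.irrefl _ hxy, h hxy, h hxy.symm, Γ.loopless.irrefl _ hxy])

theorem pairHom_proj [DecidableEq V] (a b : V) (h : ¬ Γ.Adj a b) (w : List V) :
    pairHom a b h (proj Γ w) = FreeMonoid.ofList (w.filter fun x => x = a ∨ x = b) := by
  induction w with
  | nil => rw [proj_nil, map_one]; rfl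
  | cons x w ih =>
    rw [proj_cons, map_mul, ih, pairHom, liftHom_of, List.filter_cons]
    by_cases hx : x = a ∨ x = b <;> simp only [hx, if_true, if_false, decide_true, decide_false]
    · rfl
    · simp

theorem of_comm_proj {x : V} {u : List V} (h : ∀ y ∈ u, Γ.Adj y x) :
    proj Γ u * of Γ x = of Γ x * proj Γ u := by
  induction u with
  | nil => simp [proj_nil]
  | cons y u ih =>
    rw [proj_cons, mul_assoc, ih fun z hz => h z (by simp [hz]), ← mul_assoc,
      of_comm (h y (by simp)), mul_assoc]

theorem of_comm_of_adj {x : V} {m : TraceMonoid Γ} (h : ∀ y ∈ content m, Γ.Adj y x) :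
    m * of Γ x = of Γ x * m := by
  obtain ⟨w, rfl⟩ := proj_surjective Γ m
  exact of_comm_proj fun y hy => h y (by simpa [content_proj] using hy)

/-- If the pair projections of `w` begin with those of a word starting with `x`, then `w` has an
occurrence of `x` which can be moved to the front. -/
theorem exists_split_of_pairHom [DecidableEq V] {x : V} {w : List V} (hx : x ∈ w)
    (h : ∀ (y : V) (hy : ¬ Γ.Adj x y), ∃ t,
      pairHom x y hy (proj Γ w) = FreeMonoid.ofList (x :: t)) :
    ∃ u v, w = u ++ x :: v ∧ ∀ y ∈ u, Γ.Adj y x := by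
  obtain ⟨u, v, rfl, hu⟩ := List.eq_append_cons_of_mem hx
  refine ⟨u, v, rfl, fun y hy => ?_⟩
  by_contra hadj
  have hadj' : ¬ Γ.Adj x y := fun h => hadj h.symm
  obtain ⟨t, ht⟩ := h y hadj'
  rw [pairHom_proj, FreeMonoid.ofList.injective.eq_iff, List.filter_append] at ht
  have hmem : y ∈ u.filter fun z => z = x ∨ z = y := by simp [hy]
  cases hf : u.filter fun z => z = x ∨ z = y with
  | nil => rw [hf] at hmem; simp at hmem
  | cons z s =>
    rw [hf] at ht
    have hz : z = x := by simpa using (List.cons.inj ht).1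
    have : z ∈ u.filter fun z => z = x ∨ z = y := by rw [hf]; simp
    exact hu (hz ▸ (List.mem_filter.1 this).1)

/-- An element of the trace monoid is determined by its projections to pairs of letters that do
not commute. -/
theorem eq_of_pairHom_eq [DecidableEq V] {m m' : TraceMonoid Γ}
    (h : ∀ (a b : V) (hab : ¬ Γ.Adj a b), pairHom a b hab m = pairHom a b hab m') : m = m' := by
  obtain ⟨w, rfl⟩ := proj_surjective Γ m
  obtain ⟨w', rfl⟩ := proj_surjective Γ m'
  induction w generalizing w' with
  | nil =>
    cases w' with
    | nil => rfl
    | cons x w' =>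
      have := h x x (Γ.loopless.irrefl x)
      rw [pairHom_proj, pairHom_proj, FreeMonoid.ofList.injective.eq_iff] at this
      simp at this
  | cons x w ih =>
    have hx : x ∈ w' := by
      have := h x x (Γ.loopless.irrefl x)
      rw [pairHom_proj, pairHom_proj, FreeMonoid.ofList.injective.eq_iff] at this
      have hmem : x ∈ w'.filter fun z => z = x ∨ z = x := by rw [← this]; simp
      exact (List.mem_filter.1 hmem).1
    obtain ⟨u, v, rfl, hu⟩ := exists_split_of_pairHom (Γ := Γ) hx fun y hy => by
      refine ⟨w.filter fun z => z = x ∨ z = y, ?_⟩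
      rw [← h x y hy, pairHom_proj]
      simp
    have e : proj Γ (u ++ x :: v) = of Γ x * proj Γ (u ++ v) := by
      rw [proj_append, proj_cons, ← mul_assoc, of_comm_proj hu, mul_assoc, proj_append]
    rw [proj_cons, e, ih (u ++ v)]
    intro a b hab
    have := h a b hab
    rw [proj_cons, e, map_mul, map_mul] at this
    exact mul_left_cancel this

/-- The pair projections jointly embed `M` into a product of free monoids, where cancellation holds.
-/
instance instIsCancelMul : IsCancelMul (TraceMonoid Γ) where
  mul_left_cancel a b c h := by
    classical
    refine eq_of_pairHom_eq fun x y hxy => ?_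
    have := congrArg (pairHom x y hxy) h
    simp only [map_mul] at this
    exact mul_left_cancel this
  mul_right_cancel a b c h := by
    classical
    refine eq_of_pairHom_eq fun x y hxy => ?_
    have := congrArg (pairHom x y hxy) h
    simp only [map_mul] at this
    exact mul_right_cancel this

theorem exists_split {x : V} {m : TraceMonoid Γ} {w : List V} (h : proj Γ w = of Γ x * m) :
    ∃ u v, w = u ++ x :: v ∧ ∀ y ∈ u, Γ.Adj y x := by
  classical
  refine exists_split_of_pairHom (Γ := Γ) ?_ fun y hy => ?_
  · have := congrArg content h
    rw [content_proj, content_mul, content_of] at this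
    rw [← Multiset.mem_coe, this]
    simp
  · refine ⟨FreeMonoid.toList (pairHom x y hy m), ?_⟩
    rw [h, map_mul, pairHom, liftHom_of]
    simp only [true_or, if_true]
    rfl

/-- Every initial letter of a product is an initial letter of the first factor, or commutes with
the first factor and is an initial letter of the second one. -/
theorem dvd_mul_cases {x : V} {a b : TraceMonoid Γ} (h : of Γ x ∣ a * b) :
    of Γ x ∣ a ∨ (∀ y ∈ content a, Γ.Adj y x) ∧ of Γ x ∣ b := by
  obtain ⟨wa, rfl⟩ := proj_surjective Γ a
  obtain ⟨wb, rfl⟩ := proj_surjective Γ b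
  obtain ⟨m, hm⟩ := h
  rw [← proj_append] at hm
  obtain ⟨u, v, e, hu⟩ := exists_split hm
  have key : ∀ c d : List V, (∀ y ∈ c, Γ.Adj y x) → of Γ x ∣ proj Γ (c ++ x :: d) := by
    intro c d hc
    rw [proj_append, proj_cons, ← mul_assoc, of_comm_proj hc, mul_assoc]
    exact dvd_mul_right _ _
  rcases List.append_eq_append_iff.1 e with ⟨c, rfl, rfl⟩ | ⟨c, rfl, hc⟩
  · refine Or.inr ⟨fun y hy => hu y ?_, key c v fun y hy => hu y (by simp [hy])⟩
    rw [content_proj] at hy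
    simp [Multiset.mem_coe.1 hy]
  · rcases c with _ | ⟨z, c⟩
    · refine Or.inr ⟨fun y hy => hu y ?_, ?_⟩
      · rw [content_proj] at hy
        simpa using hy
      · rw [List.nil_append] at hc
        rw [← hc]
        exact key [] v (by simp)
    · rw [List.cons_append] at hc
      obtain ⟨rfl, -⟩ := List.cons.inj hc
      exact Or.inl (key u c hu)

theorem mem_content_of_dvd {x : V} {m : TraceMonoid Γ} (h : of Γ x ∣ m) : x ∈ content m := by
  obtain ⟨n, rfl⟩ := h
  simp [content_mul, content_of]

theorem content_eq_zero {m : TraceMonoid Γ} : content m = 0 ↔ m = 1 := by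
  refine ⟨fun h => ?_, fun h => h ▸ content_one⟩
  obtain ⟨w, rfl⟩ := proj_surjective Γ m
  rw [content_proj, Multiset.coe_eq_zero] at h
  rw [h, proj_nil]

theorem exists_of_dvd {m : TraceMonoid Γ} (h : m ≠ 1) : ∃ x, of Γ x ∣ m := by
  induction m using induction_on with
  | one => exact absurd rfl h
  | of_mul x m _ => exact ⟨x, dvd_mul_right _ _⟩

theorem of_injective : Function.Injective (of Γ) := fun x y h => by
  have := congrArg content h
  rw [content_of, content_of] at this
  simpa using this

open Classical in
/-- Deletion of the letters outside of a given set. -/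
noncomputable def restrict (A : Set V) : TraceMonoid Γ →* TraceMonoid Γ :=
  liftHom (fun x => if x ∈ A then of Γ x else 1) fun x y h => by
    by_cases hx : x ∈ A <;> by_cases hy : y ∈ A <;> simp [hx, hy, of_comm h]

theorem restrict_of_mem {A : Set V} {x : V} (h : x ∈ A) : restrict A (of Γ x) = of Γ x := by
  rw [restrict, liftHom_of, if_pos h]

theorem restrict_of_notMem {A : Set V} {x : V} (h : x ∉ A) : restrict A (of Γ x) = 1 := by
  rw [restrict, liftHom_of, if_neg h]

theorem mem_of_mem_content_restrict {A : Set V} {m : TraceMonoid Γ} {x : V}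
    (h : x ∈ content (restrict A m)) : x ∈ A := by
  induction m using induction_on with
  | one => simp [content_one] at h
  | of_mul y m ih =>
    rw [map_mul, content_mul, Multiset.mem_add] at h
    refine h.elim (fun h => ?_) ih
    by_cases hy : y ∈ A
    · rw [restrict_of_mem hy, content_of, Multiset.mem_singleton] at h
      rwa [h]
    · simp [restrict_of_notMem hy, content_one] at h

theorem restrict_eq_self {A : Set V} {m : TraceMonoid Γ} (h : ∀ x ∈ content m, x ∈ A) :
    restrict A m = m := by
  induction m using induction_on with
  | one => exact map_one _
  | of_mul y m ih =>
    simp only [content_mul, content_of, Multiset.mem_add, Multiset.mem_singleton] at h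
    rw [map_mul, restrict_of_mem (h y (Or.inl rfl)), ih fun x hx => h x (Or.inr hx)]

theorem mul_comm_of_adj {a b : TraceMonoid Γ}
    (h : ∀ x ∈ content a, ∀ y ∈ content b, Γ.Adj x y) : a * b = b * a := by
  induction b using induction_on with
  | one => simp
  | of_mul z b ih =>
    simp only [content_mul, content_of, Multiset.mem_add, Multiset.mem_singleton] at h
    rw [← mul_assoc, of_comm_of_adj fun x hx => h x hx z (Or.inl rfl), mul_assoc,
      ih fun x hx y hy => h x hx y (Or.inr hy), mul_assoc]

/-- An element whose letters lie in two sets commuting with each other is the product of its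
restrictions to these sets. -/
theorem eq_restrict_mul_restrict {A B : Set V} (hAB : ∀ x ∈ A, ∀ y ∈ B, Γ.Adj x y)
    {m : TraceMonoid Γ} (h : ∀ x ∈ content m, x ∈ A ∨ x ∈ B) :
    m = restrict A m * restrict B m := by
  induction m using induction_on with
  | one => simp
  | of_mul z m ih =>
    simp only [content_mul, content_of, Multiset.mem_add, Multiset.mem_singleton] at h
    have ih := ih fun x hx => h x (Or.inr hx)
    rw [map_mul, map_mul]
    rcases h z (Or.inl rfl) with hz | hz
    · have hzB : z ∉ B := fun hB => Γ.loopless.irrefl z (hAB z hz z hB)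
      rw [restrict_of_mem hz, restrict_of_notMem hzB, one_mul, mul_assoc, ← ih]
    · have hzA : z ∉ A := fun hA => Γ.loopless.irrefl z (hAB z hA z hz)
      rw [restrict_of_mem hz, restrict_of_notMem hzA, one_mul, ← mul_assoc,
        of_comm_of_adj fun y hy => hAB y (mem_of_mem_content_restrict hy) z hz, mul_assoc, ← ih]

/-- For one transposition `(xy)x = x(yx)`, and conjugators multiply along a chain. -/
theorem Conjugate.exists_mul_eq {a b : TraceMonoid Γ} (h : Conjugate a b) :
    ∃ z, a * z = z * b := by
  induction h with
  | refl => exact ⟨1, by simp⟩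
  | tail _ h ih =>
    obtain ⟨z, hz⟩ := ih
    obtain ⟨x, y, rfl, rfl⟩ := h
    exact ⟨z * x, by rw [← mul_assoc, hz]; simp only [mul_assoc]⟩

theorem Conjugate.content_eq {a b : TraceMonoid Γ} (h : Conjugate a b) :
    content a = content b := by
  obtain ⟨z, hz⟩ := h.exists_mul_eq
  have := congrArg content hz
  rw [content_mul, content_mul, add_comm] at this
  exact add_left_cancel this

end Basic

end TraceMonoid

/-! ### Lyndon elements and their standard words. -/

namespace List

variable {α : Type*} [LinearOrder α]

/-- If `z = wc`, then `wc = cw'` with a shorter `c`. Otherwise `w = zc` and `w' = cz`, a rotation of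
`w`. -/
theorem IsLyndonWord.le_of_append_eq {w w' z : List α} (hw : IsLyndonWord w)
    (h : w ++ z = z ++ w') : w ≤ w' := by
  induction hn : z.length using Nat.strong_induction_on generalizing z with
  | _ n ih =>
    rcases List.append_eq_append_iff.1 h with ⟨c, rfl, hc⟩ | ⟨c, hc, rfl⟩
    · refine ih c.length ?_ hc rfl
      have := List.length_pos_iff.2 hw.ne_nil
      rw [← hn, List.length_append]
      omega
    · rcases eq_or_ne c [] with rfl | hc'
      · simp [hc]
      · exact (hw.le_suffix hc' hc).trans (le_append_lex c z)

end List

namespace TraceMonoid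

open List (IsLyndonWord)

section Std

variable {V : Type*} {Γ : SimpleGraph V} [LinearOrder V]

/-- All letters of `n` are at least `s`, and no other letter than `s` can be moved to the
front. -/
structure Rooted (s : V) (n : TraceMonoid Γ) : Prop where
  le : ∀ x ∈ content n, s ≤ x
  eq_of_dvd : ∀ x, of Γ x ∣ n → x = s

theorem Rooted.mul {s : V} {a b : TraceMonoid Γ} (ha : Rooted s a) (hb : Rooted s b) :
    Rooted s (a * b) := by
  refine ⟨fun x hx => ?_, fun x hx => ?_⟩
  · rw [content_mul, Multiset.mem_add] at hx
    exact hx.elim (ha.le x) (hb.le x)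
  · rcases dvd_mul_cases hx with h | ⟨-, h⟩
    exacts [ha.eq_of_dvd x h, hb.eq_of_dvd x h]

/-- Initial letters other than `s` are stripped off until none is left. -/
theorem exists_eq_mul_rooted (s : V) (z : TraceMonoid Γ) (hz : ∀ x ∈ content z, s ≤ x) :
    ∃ c p, z = c * p ∧ (∀ x ∈ content c, s < x) ∧ Rooted s p := by
  induction hn : z.length using Nat.strong_induction_on generalizing z with
  | _ n ih =>
    by_cases h : ∀ x, of Γ x ∣ z → x = s
    · exact ⟨1, z, by simp, by simp [content_one], hz, h⟩
    push Not at h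
    obtain ⟨x, ⟨z', rfl⟩, hx⟩ := h
    simp only [content_mul, content_of, Multiset.mem_add, Multiset.mem_singleton] at hz
    obtain ⟨c, p, rfl, hc, hp⟩ := ih z'.length (by rw [← hn, length_mul, length_of]; omega) z'
      (fun y hy => hz y (Or.inr hy)) rfl
    refine ⟨of Γ x * c, p, by rw [mul_assoc], fun y hy => ?_, hp⟩
    rw [content_mul, content_of, Multiset.mem_add, Multiset.mem_singleton] at hy
    rcases hy with rfl | hy
    exacts [(hz y (Or.inl rfl)).lt_of_ne hx.symm, hc y hy]

theorem mul_rooted_unique {s : V} {c c' n n' : TraceMonoid Γ} (hc : ∀ x ∈ content c, s < x)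
    (hc' : ∀ x ∈ content c', s < x) (hn : Rooted s n) (hn' : Rooted s n')
    (h : c * n = c' * n') : c = c' ∧ n = n' := by
  induction c using induction_on generalizing c' with
  | one =>
    rw [one_mul] at h
    have h1 : c' = 1 := by
      by_contra hne
      obtain ⟨x, hx⟩ := exists_of_dvd hne
      have h1 := hn.eq_of_dvd x (h ▸ hx.mul_right n')
      exact (hc' x (mem_content_of_dvd hx)).ne h1.symm
    subst h1
    exact ⟨rfl, by rwa [one_mul] at h⟩
  | of_mul x c ih =>
    have hx : s < x := hc x (by simp [content_mul, content_of])
    rw [mul_assoc] at h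
    rcases dvd_mul_cases (h ▸ dvd_mul_right _ _ : of Γ x ∣ c' * n') with ⟨d, rfl⟩ | ⟨-, h1⟩
    · rw [mul_assoc] at h
      obtain ⟨rfl, rfl⟩ := ih (fun y hy => hc y (by simp [content_mul, hy]))
        (fun y hy => hc' y (by simp [content_mul, hy])) (mul_left_cancel h)
      exact ⟨rfl, rfl⟩
    · exact absurd (hn'.eq_of_dvd x h1) hx.ne'

/-- The letters of `c` are pushed leftwards through `a` one at a time. A letter either commutes with
all of the current rooted factor and reaches the front, or is absorbed into that factor, which stays
rooted. If no length is lost, nothing was absorbed, so `c` and `a` commute letter by letter. -/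
theorem exists_rooted_mul_eq {s : V} {a c : TraceMonoid Γ} (ha : Rooted s a)
    (hc : ∀ x ∈ content c, s < x) :
    ∃ c' a', a * c = c' * a' ∧ Rooted s a' ∧ (∀ x ∈ content c', s < x) ∧
      c'.length ≤ c.length ∧ (c'.length = c.length →
        c' = c ∧ a' = a ∧ ∀ x ∈ content c, ∀ y ∈ content a, Γ.Adj x y) := by
  induction c using induction_on generalizing a with
  | one => exact ⟨1, a, by simp, ha, hc, le_rfl, fun _ => ⟨rfl, rfl, by simp [content_one]⟩⟩
  | of_mul x c ih =>
    have hx : s < x := hc x (by simp [content_mul, content_of])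
    have hc' : ∀ y ∈ content c, s < y := fun y hy => hc y (by simp [content_mul, hy])
    by_cases h : ∀ y, of Γ y ∣ a * of Γ x → y = s
    · have hax : Rooted s (a * of Γ x) := by
        refine ⟨fun y hy => ?_, h⟩
        rw [content_mul, content_of, Multiset.mem_add, Multiset.mem_singleton] at hy
        rcases hy with hy | rfl
        exacts [ha.le y hy, hx.le]
      obtain ⟨c', a', h1, h2, h3, h4, -⟩ := ih hax hc'
      refine ⟨c', a', by rw [← h1, mul_assoc], h2, h3, ?_, ?_⟩ <;>
        rw [length_mul, length_of] <;> omega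
    · push Not at h
      obtain ⟨y, hy, hys⟩ := h
      rcases dvd_mul_cases hy with hy | ⟨hadj, hy⟩
      · exact absurd (ha.eq_of_dvd y hy) hys
      have hyx : y = x := by simpa [content_of] using mem_content_of_dvd hy
      subst hyx
      obtain ⟨c', a', h1, h2, h3, h4, h5⟩ := ih ha hc'
      refine ⟨of Γ y * c', a', ?_, h2, ?_, ?_, ?_⟩
      · rw [← mul_assoc, of_comm_of_adj hadj, mul_assoc, h1, mul_assoc]
      · intro z hz
        rw [content_mul, content_of, Multiset.mem_add, Multiset.mem_singleton] at hz
        rcases hz with rfl | hz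
        exacts [hx, h3 z hz]
      · rw [length_mul, length_mul]
        omega
      · intro hl
        rw [length_mul, length_mul] at hl
        obtain ⟨rfl, rfl, h6⟩ := h5 (by omega)
        refine ⟨rfl, rfl, fun z hz => ?_⟩
        rw [content_mul, content_of, Multiset.mem_add, Multiset.mem_singleton] at hz
        rcases hz with rfl | hz
        exacts [fun t ht => (hadj t ht).symm, h6 z hz]

/-- Write a conjugate as `cn` with `n` rooted and pass to `nc = c'n'`. As long as `c'` is shorter
than `c`, this can be repeated. If it is not, the letters of `c` commute with those of `n`, and `m`,
having the same letters, splits into two commuting nontrivial factors. -/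
theorem Primitive.exists_conjugate_rooted {m : TraceMonoid Γ} (hm : Primitive m) {s : V}
    (hs : s ∈ content m) (hle : ∀ x ∈ content m, s ≤ x) :
    ∃ m', Conjugate m m' ∧ Rooted s m' := by
  have key : ∀ (k : ℕ) (c n : TraceMonoid Γ), c.length = k → Rooted s n →
      (∀ x ∈ content c, s < x) → Conjugate m (c * n) → ∃ m', Conjugate m m' ∧ Rooted s m' := by
    intro k
    induction k using Nat.strong_induction_on with
    | _ k ih =>
      intro c n hk hn hc hconj
      rcases eq_or_ne c 1 with rfl | hc1
      · exact ⟨n, by simpa using hconj, hn⟩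
      obtain ⟨c', n', h1, h2, h3, h4, h5⟩ := exists_rooted_mul_eq hn hc
      rcases h4.lt_or_eq with h4 | h4
      · refine ih c'.length (by omega) c' n' rfl h2 h3 ?_
        rw [← h1]
        exact hconj.tail ⟨c, n, rfl, rfl⟩
      · exfalso
        obtain ⟨-, -, hadj⟩ := h5 h4
        have hcont : content m = content c + content n := by
          rw [hconj.content_eq, content_mul]
        set A : Set V := {x | x ∈ content c}
        set B : Set V := {x | x ∈ content n}
        have hAB : ∀ x ∈ A, ∀ y ∈ B, Γ.Adj x y := hadj
        have hm1 : m = restrict A m * restrict B m := by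
          refine eq_restrict_mul_restrict hAB fun x hx => ?_
          rw [hcont, Multiset.mem_add] at hx
          exact hx
        have hm2 : restrict A m * restrict B m = restrict B m * restrict A m :=
          mul_comm_of_adj fun x hx y hy =>
            hAB x (mem_of_mem_content_restrict hx) y (mem_of_mem_content_restrict hy)
        refine hm ⟨restrict A m, restrict B m, fun hA => ?_, fun hB => ?_, hm1, hm1.trans hm2⟩
        · obtain ⟨x, hx⟩ := exists_of_dvd hc1
          have hxc := mem_content_of_dvd hx
          have hxm : x ∈ content m := by rw [hcont, Multiset.mem_add]; exact Or.inl hxc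
          rw [hA, one_mul] at hm1
          rw [hm1] at hxm
          exact Γ.loopless.irrefl x (hAB x hxc x (mem_of_mem_content_restrict hxm))
        · rw [hB, mul_one] at hm1
          rw [hm1] at hs
          exact (hc s (mem_of_mem_content_restrict (A := A) hs)).ne rfl
  obtain ⟨c, p, e, hc, hp⟩ := exists_eq_mul_rooted s m hle
  exact key _ c p rfl hp hc (e ▸ Relation.ReflTransGen.refl)

variable [Finite V]

theorem le_iff_std {a b : TraceMonoid Γ} : a ≤ b ↔ std a ≤ std b := Iff.rfl

theorem lt_iff_std {a b : TraceMonoid Γ} : a < b ↔ std a < std b := Iff.rfl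

theorem le_std {w : List V} {m : TraceMonoid Γ} (h : proj Γ w = m) : w ≤ std m :=
  (exists_isGreatest_fiber m).choose_spec.2 h

theorem length_std (m : TraceMonoid Γ) : (std m).length = m.length := by
  conv_rhs => rw [← proj_std m, length_proj]

theorem mem_std {m : TraceMonoid Γ} {x : V} : x ∈ std m ↔ x ∈ content m := by
  conv_rhs => rw [← proj_std m, content_proj, Multiset.mem_coe]

theorem std_eq_nil {m : TraceMonoid Γ} : std m = [] ↔ m = 1 := by
  rw [← List.length_eq_zero_iff, length_std, length_eq_zero]

theorem std_append_le (a b : TraceMonoid Γ) : std a ++ std b ≤ std (a * b) :=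
  le_std (by rw [proj_append, proj_std, proj_std])

/-- The factors of a standard word are standard. -/
theorem std_proj_of_append {m : TraceMonoid Γ} {u v : List V} (h : std m = u ++ v) :
    std (proj Γ u) = u ∧ std (proj Γ v) = v := by
  have hm : proj Γ u * proj Γ v = m := by rw [← proj_append, ← h, proj_std]
  constructor
  · refine le_antisymm ?_ (le_std rfl)
    have h1 : std (proj Γ u) ++ v ≤ u ++ v := by
      rw [← h]
      exact le_std (by rw [proj_append, proj_std, hm])
    exact List.le_of_append_le_append h1 (by rw [length_std, length_proj])
  · refine le_antisymm ?_ (le_std rfl)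
    have h1 : u ++ std (proj Γ v) ≤ u ++ v := by
      rw [← h]
      exact le_std (by rw [proj_append, proj_std, hm])
    exact (List.append_le_append_left_iff u).1 h1

theorem eq_of_mul_proj_of_std {m : TraceMonoid Γ} {x : V} {w : List V} (h : std m = x :: w) :
    m = of Γ x * proj Γ w := by
  rw [← proj_cons, ← h, proj_std]

theorem le_head_of_dvd {m : TraceMonoid Γ} {x y : V} {w : List V} (h : std m = x :: w)
    (hy : of Γ y ∣ m) : y ≤ x := by
  obtain ⟨n, rfl⟩ := hy
  have := le_std (m := of Γ y * n) (w := y :: std n) (by rw [proj_cons, proj_std])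
  rw [h] at this
  rcases List.cons_le_cons_iff_lex.1 this with h | h
  exacts [h.le, h.1.le]

theorem exists_std_eq_cons {m : TraceMonoid Γ} (h : m ≠ 1) : ∃ x w, std m = x :: w :=
  List.exists_cons_of_ne_nil (mt std_eq_nil.1 h)

theorem rooted_of_std {m : TraceMonoid Γ} {s : V} {w : List V} (h : std m = s :: w)
    (hs : ∀ x ∈ content m, s ≤ x) : Rooted s m :=
  ⟨hs, fun x hx => le_antisymm (le_head_of_dvd h hx) (hs x (mem_content_of_dvd hx))⟩

/-- A letter of `n` that can move in front of a nontrivial `a` must be `s`. It commutes with the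
letters of `a`, which are therefore strictly larger than `s`, so moving it there only makes the word
smaller. -/
theorem std_mul_of_rooted {s : V} {a n : TraceMonoid Γ} (ha : ∀ x ∈ content a, s ≤ x)
    (hn : Rooted s n) : std (a * n) = std a ++ std n := by
  refine le_antisymm ?_ (std_append_le a n)
  have key : ∀ (w : List V) (a : TraceMonoid Γ), (∀ x ∈ content a, s ≤ x) →
      proj Γ w = a * n → w ≤ std a ++ std n := by
    intro w
    induction w with
    | nil => exact fun a _ _ => List.nil_le_lex _
    | cons x w ih =>
      intro a ha h
      have hdvd : of Γ x ∣ a * n := ⟨proj Γ w, by rw [← h, proj_cons]⟩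
      rcases dvd_mul_cases hdvd with ⟨b, rfl⟩ | ⟨hadj, hx⟩
      · rw [proj_cons, mul_assoc] at h
        have h1 := ih b (fun y hy => ha y (by simp [content_mul, hy])) (mul_left_cancel h)
        have h2 : x :: std b ≤ std (of Γ x * b) := le_std (by rw [proj_cons, proj_std])
        calc x :: w ≤ (x :: std b) ++ std n := List.cons_le_cons x h1
          _ ≤ _ := List.append_le_append_of_le h2
            (by rw [length_std, length_mul, length_of, List.length_cons, length_std, add_comm])
            le_rfl
      · rcases eq_or_ne a 1 with rfl | ha1
        · rw [std_eq_nil.2 rfl, List.nil_append]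
          exact le_std (by rw [h, one_mul])
        · obtain ⟨y, v, hv⟩ := exists_std_eq_cons ha1
          have hy : y ∈ content a := mem_std.1 (by simp [hv])
          rw [hn.eq_of_dvd x hx] at hadj ⊢
          rw [hv, List.cons_append]
          exact (List.cons_lt_cons_iff_lex.2
            (Or.inl ((ha y hy).lt_of_ne (hadj y hy).ne'))).le
  exact key _ a ha (proj_std _)

/-- The standard word of a product `x * y` has a suffix which is at most the standard word
of `y`. -/
theorem exists_suffix_le_std {x y : TraceMonoid Γ} (hy : y ≠ 1) :
    ∃ u r, r ≠ [] ∧ std (x * y) = u ++ r ∧ r ≤ std y ∧ (x ≠ 1 → u ≠ []) := by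
  induction hn : (x * y).length using Nat.strong_induction_on generalizing x y with
  | _ n ih =>
    obtain ⟨v, w, hw⟩ : ∃ v w, std (x * y) = v :: w := by
      refine exists_std_eq_cons fun h => ?_
      have := congrArg length h
      rw [length_mul, length_one] at this
      have := length_pos hy
      omega
    have hdvd : of Γ v ∣ x * y := ⟨proj Γ w, eq_of_mul_proj_of_std hw⟩
    have hw' := (std_proj_of_append (u := [v]) (v := w) hw).2
    rcases dvd_mul_cases hdvd with ⟨x', rfl⟩ | ⟨hadj, y', rfl⟩
    · have e : x' * y = proj Γ w := by
        have := eq_of_mul_proj_of_std hw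
        rw [mul_assoc] at this
        exact mul_left_cancel this
      obtain ⟨u, r, hr, h1, h2, -⟩ := ih (x' * y).length (by
        rw [← hn, mul_assoc, length_mul (of Γ v), length_of]; omega) hy rfl
      refine ⟨v :: u, r, hr, ?_, h2, by simp⟩
      rw [hw, ← hw', ← e, h1, List.cons_append]
    · rcases eq_or_ne x 1 with rfl | hx
      · exact ⟨[], _, mt std_eq_nil.1 hy, by rw [one_mul, List.nil_append], le_rfl, by simp⟩
      -- The first letter `v` comes from `y` and overtakes `x`. An initial letter `a` of `x` is then
      -- smaller than `v`, hence smaller than the first letter of `std y`; the suffix starting at an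
      -- occurrence of `a` will do.
      · obtain ⟨a, ha⟩ := exists_of_dvd hx
        have hav := hadj a (mem_content_of_dvd ha)
        have hlt : a < v := (le_head_of_dvd hw (ha.mul_right _)).lt_of_ne hav.ne
        have hmem : a ∈ std (x * (of Γ v * y')) := by
          rw [mem_std, content_mul, Multiset.mem_add]
          exact Or.inl (mem_content_of_dvd ha)
        rw [hw, List.mem_cons] at hmem
        obtain ⟨p, q, rfl⟩ := List.append_of_mem (hmem.resolve_left hlt.ne)
        refine ⟨v :: p, a :: q, by simp, by rw [hw, List.cons_append], ?_, by simp⟩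
        obtain ⟨b, t, hb⟩ := exists_std_eq_cons hy
        rw [hb]
        exact (List.cons_lt_cons_iff_lex.2
          (Or.inl (hlt.trans_le (le_head_of_dvd hb (dvd_mul_right _ _))))).le

theorem exists_std_append_eq_of_rooted {s : V} {a b z : TraceMonoid Γ} (ha : Rooted s a)
    (hb : Rooted s b) (h : a * z = z * b) : ∃ t, std a ++ t = t ++ std b := by
  -- Letters of `z` below `s` are deleted; `a` and `b` contain none. After writing the rest as `cp`,
  -- uniqueness shows that pushing `c` through `a` loses no letters, so `c` commutes with `a` and
  -- cancels, leaving `ap = pb` with `p` rooted.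
  have h' := congrArg (restrict (Set.Ici s)) h
  rw [map_mul, map_mul, 
    (restrict_eq_self ha.le : restrict (Set.Ici s) a = a),
    (restrict_eq_self hb.le : restrict (Set.Ici s) b = b)] at h'
  obtain ⟨c, p, hz, hc, hp⟩ := exists_eq_mul_rooted s (restrict (Set.Ici s) z)
    fun x hx => mem_of_mem_content_restrict hx
  obtain ⟨c', a', h1, h2, h3, -, h5⟩ := exists_rooted_mul_eq ha hc
  rw [hz, ← mul_assoc, h1, mul_assoc, mul_assoc] at h'
  obtain ⟨rfl, h6⟩ := mul_rooted_unique h3 hc (h2.mul hp) (hp.mul hb) h'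
  obtain ⟨-, rfl, -⟩ := h5 rfl
  exact ⟨std p, by rw [← std_mul_of_rooted ha.le hp, h6, std_mul_of_rooted hp.le hb]⟩

theorem rooted_of_isLyndonWord {m : TraceMonoid Γ} {s : V} {w : List V} (h : std m = s :: w)
    (hm : IsLyndonWord (std m)) : Rooted s m := by
  refine rooted_of_std h fun x hx => ?_
  rw [h] at hm
  exact hm.head_le (h ▸ mem_std.2 hx)

theorem lt_mul_of_isLyndonWord {x y : TraceMonoid Γ} (h : IsLyndonWord (std (x * y)))
    (hx : x ≠ 1) (hy : y ≠ 1) : x * y < y := by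
  obtain ⟨u, r, hr, h1, h2, h3⟩ := exists_suffix_le_std (x := x) hy
  exact lt_iff_std.2 ((h.lt_suffix u r (h3 hx) hr h1).trans_le h2)

/-- If `m = xy = yx`, then `m < y`, although `std y` is a prefix of a word representing `m`. For
minimality, a conjugate with an initial letter other than `s` has a standard word starting with a
larger letter; a rooted conjugate reduces to conjugation of words. -/
theorem isLyndon_of_isLyndonWord {m : TraceMonoid Γ} (h : IsLyndonWord (std m)) :
    IsLyndon m := by
  have hm : m ≠ 1 := fun h1 => h.ne_nil (std_eq_nil.2 h1)
  refine ⟨hm, ?_, fun b hb => ?_⟩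
  · rintro ⟨x, y, hx, hy, rfl, e⟩
    have h1 := lt_iff_std.1 (lt_mul_of_isLyndonWord h hx hy)
    rw [e] at h1
    exact absurd ((List.le_append_lex _ _).trans (std_append_le y x)) h1.not_ge
  · obtain ⟨s, w, hw⟩ := exists_std_eq_cons hm
    have hs := rooted_of_isLyndonWord hw h
    rw [le_iff_std]
    have hcont := hb.content_eq
    by_cases hbs : ∀ x, of Γ x ∣ b → x = s
    · obtain ⟨z, hz⟩ := hb.exists_mul_eq
      obtain ⟨t, ht⟩ := exists_std_append_eq_of_rooted hs ⟨hcont ▸ hs.le, hbs⟩ hz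
      exact h.le_of_append_eq ht
    · push Not at hbs
      obtain ⟨x, hx, hxs⟩ := hbs
      have hb1 : b ≠ 1 := by
        rintro rfl
        simpa [content_one] using mem_content_of_dvd hx
      obtain ⟨y, v, hv⟩ := exists_std_eq_cons hb1
      have hsx : s ≤ x := hs.le x (hcont ▸ mem_content_of_dvd hx)
      rw [hw, hv]
      exact (List.cons_lt_cons_iff_lex.2
        (Or.inl ((hsx.lt_of_ne hxs.symm).trans_le (le_head_of_dvd hv hx)))).le

/-- Comparison with a rooted conjugate shows that `std m` starts with its smallest letter `s`. A
rotation starting with another letter is clearly larger. In a rotation `vu` starting with `s` both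
pieces are rooted, so `vu` is itself a standard word, that of a transposed element, and primitivity
makes the inequality strict. -/
theorem IsLyndon.isLyndonWord {m : TraceMonoid Γ} (hm : IsLyndon m) : IsLyndonWord (std m) := by
  classical
  obtain ⟨s, hs, hle⟩ := Finset.exists_min_image (content m).toFinset id (by
    rw [Multiset.toFinset_nonempty]
    exact mt content_eq_zero.1 hm.ne_one)
  simp only [Multiset.mem_toFinset, id] at hs hle
  obtain ⟨m', hconj, hm'⟩ := hm.primitive.exists_conjugate_rooted hs hle
  have hmm' := le_iff_std.1 (hm.le_of_conjugate m' hconj)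
  obtain ⟨a, w, hw⟩ := exists_std_eq_cons hm.ne_one
  have hm'1 : m' ≠ 1 := by
    rintro rfl
    have := hconj.content_eq
    rw [content_one, content_eq_zero] at this
    exact hm.ne_one this
  obtain ⟨b, w', hw'⟩ := exists_std_eq_cons hm'1
  have hb : b = s := hm'.eq_of_dvd b ⟨_, eq_of_mul_proj_of_std hw'⟩
  have ha : a = s := by
    refine le_antisymm ?_ (hle a (mem_std.1 (by simp [hw])))
    rw [hw, hw', hb] at hmm'
    rcases List.cons_le_cons_iff_lex.1 hmm' with h | h
    exacts [h.le, h.1.le]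
  subst ha
  refine List.isLyndonWord_of_lt_rotation (by simp [hw]) fun u v hu hv e => ?_
  have hletters : ∀ x ∈ u ++ v, a ≤ x := fun x hx => hle x (mem_std.1 (e ▸ hx))
  obtain ⟨b, v', rfl⟩ := List.exists_cons_of_ne_nil hv
  rcases (hletters b (by simp)).eq_or_lt with rfl | hab
  · obtain ⟨b, u', rfl⟩ := List.exists_cons_of_ne_nil hu
    rw [hw, List.cons_append] at e
    obtain rfl := (List.cons.inj e).1
    rw [← List.cons_append, ← hw] at e
    obtain ⟨h1, h2⟩ := std_proj_of_append e
    have hv' : Rooted a (proj Γ (a :: v')) := by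
      refine rooted_of_std h2 fun x hx => hletters x ?_
      rw [content_proj, Multiset.mem_coe] at hx
      exact List.mem_append_right _ hx
    have hu' : Rooted a (proj Γ (a :: u')) := by
      refine rooted_of_std h1 fun x hx => hletters x ?_
      rw [content_proj, Multiset.mem_coe] at hx
      exact List.mem_append_left _ hx
    have hmul : m = proj Γ (a :: u') * proj Γ (a :: v') := by
      rw [← proj_append, ← e, proj_std]
    have hstd := std_mul_of_rooted hv'.le hu'
    rw [h1, h2] at hstd
    rw [← hstd, ← lt_iff_std]
    refine (hm.le_of_conjugate _ (.single ⟨_, _, hmul, rfl⟩)).lt_of_ne fun h3 => ?_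
    refine hm.primitive ⟨_, _, ?_, ?_, hmul, h3⟩ <;>
    · intro h
      have := congrArg length h
      rw [length_proj, length_one] at this
      simp at this
  · rw [hw, List.cons_append]
    exact List.cons_lt_cons_iff_lex.2 (Or.inl hab)

theorem isLyndon_iff {m : TraceMonoid Γ} : IsLyndon m ↔ IsLyndonWord (std m) :=
  ⟨IsLyndon.isLyndonWord, isLyndon_of_isLyndonWord⟩

/-- The standard factorisation of a Lyndon element is that of its standard word. -/
theorem IsLyndon.exists_isStandardFactorisation {m : TraceMonoid Γ} (hm : IsLyndon m)
    (hl : 1 < m.length) :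
    ∃ x y, IsStandardFactorisation m x y ∧ std m = std x ++ std y ∧
      ∀ x' y', IsStandardFactorisation m x' y' → x' = x ∧ y' = y := by
  obtain ⟨l, r, hL, hR, e, hmin⟩ := hm.isLyndonWord.exists_factorisation
    (by rwa [length_std])
  obtain ⟨hl', hr'⟩ := std_proj_of_append e
  -- Each competing factorisation yields a proper suffix of `std m` at most `std y'`, and `r` is the
  -- smallest proper nonempty suffix.
  have hle : ∀ x' y', IsLyndon x' → IsLyndon y' → x' * y' = m → proj Γ r ≤ y' := by
    intro x' y' hx hy h
    obtain ⟨u, v, hv, h1, h2, h3⟩ := exists_suffix_le_std (x := x') hy.ne_one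
    rw [h] at h1
    rw [le_iff_std, hr']
    exact (hmin u v (h3 hx.ne_one) hv h1).trans h2
  have hf : IsStandardFactorisation m (proj Γ l) (proj Γ r) :=
    ⟨isLyndon_iff.2 (by rwa [hl']), isLyndon_iff.2 (by rwa [hr']),
      by rw [← proj_append, ← e, proj_std], hle⟩
  refine ⟨_, _, hf, by rw [hl', hr', e], fun x' y' h => ?_⟩
  have hy : y' = proj Γ r :=
    le_antisymm (h.le _ _ hf.left hf.right hf.mul_eq) (hle _ _ h.left h.right h.mul_eq)
  have := h.mul_eq.trans hf.mul_eq.symm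
  rw [hy] at this
  exact ⟨mul_right_cancel this, hy⟩

/-- The standard word of a decreasing product of Lyndon elements is the concatenation of the
standard words of the factors. -/
theorem std_prod_of_pairwise {l : List (TraceMonoid Γ)} (hl : ∀ m ∈ l, IsLyndon m)
    (hs : l.Pairwise (· ≥ ·)) : std l.prod = (l.map std).flatten := by
  induction l using List.reverseRecOn with
  | nil => simp [std_eq_nil]
  | append_singleton l n ih =>
    have hn := hl n (by simp)
    obtain ⟨hs1, -, hs2⟩ := List.pairwise_append.1 hs
    obtain ⟨s, w, hw⟩ := exists_std_eq_cons hn.ne_one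
    rw [List.prod_append, List.prod_singleton, List.map_append, List.flatten_append,
      ← ih (fun x hx => hl x (by simp [hx])) hs1]
    simp only [List.map_cons, List.map_nil, List.flatten_cons, List.flatten_nil, List.append_nil]
    -- The last factor is rooted at its first letter `s`. Each earlier factor is at least as large,
    -- so its first letter, which is its smallest, is at least `s`.
    refine std_mul_of_rooted (s := s) (fun x hx => ?_) (rooted_of_isLyndonWord hw hn.isLyndonWord)
    obtain ⟨k, hk, hxk⟩ : ∃ k ∈ l, x ∈ content k := by
      clear ih hs hl hs1 hs2
      induction l with
      | nil => simp [content_one] at hx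
      | cons k l ih =>
        rw [List.prod_cons, content_mul, Multiset.mem_add] at hx
        rcases hx with hx | hx
        · exact ⟨k, by simp, hx⟩
        · obtain ⟨j, hj, hj'⟩ := ih hx
          exact ⟨j, by simp [hj], hj'⟩
    have hkL := hl k (by simp [hk])
    obtain ⟨t, v, hv⟩ := exists_std_eq_cons hkL.ne_one
    have hst := le_iff_std.1 (hs2 k hk n (by simp))
    rw [hw, hv] at hst
    have hst' : s ≤ t := by
      rcases List.cons_le_cons_iff_lex.1 hst with h | h
      exacts [h.le, h.1.le]
    exact hst'.trans ((rooted_of_isLyndonWord hv hkL.isLyndonWord).le x hxk)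

theorem eq_of_pairwise_prod_eq {l l' : List (TraceMonoid Γ)} (hl : ∀ m ∈ l, IsLyndon m)
    (hs : l.Pairwise (· ≥ ·)) (hl' : ∀ m ∈ l', IsLyndon m) (hs' : l'.Pairwise (· ≥ ·))
    (h : l.prod = l'.prod) : l = l' := by
  have hstd := congrArg std h
  rw [std_prod_of_pairwise hl hs, std_prod_of_pairwise hl' hs'] at hstd
  refine List.map_injective_iff.2 std_injective (List.lyndon_factorisation_unique ?_ ?_ ?_ ?_ hstd)
  · simpa using fun m hm => (hl m hm).isLyndonWord
  · exact List.pairwise_map.2 hs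
  · simpa using fun m hm => (hl' m hm).isLyndonWord
  · exact List.pairwise_map.2 hs'

theorem exists_pairwise_prod_eq (m : TraceMonoid Γ) :
    ∃ l : List (TraceMonoid Γ), (∀ x ∈ l, IsLyndon x) ∧ l.Pairwise (· ≥ ·) ∧ l.prod = m := by
  obtain ⟨L, hL, hs, hf⟩ := List.exists_lyndon_factorisation (std m)
  have hstd : ∀ w ∈ L, std (proj Γ w) = w := by
    intro w hw
    obtain ⟨p, q, rfl⟩ := List.append_of_mem hw
    rw [List.flatten_append, List.flatten_cons] at hf
    obtain ⟨-, h⟩ := std_proj_of_append hf.symm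
    exact (std_proj_of_append h).1
  refine ⟨L.map (proj Γ), ?_, ?_, ?_⟩
  · simp only [List.mem_map]
    rintro _ ⟨w, hw, rfl⟩
    rw [isLyndon_iff, hstd w hw]
    exact hL w hw
  · rw [List.pairwise_map]
    refine hs.imp_of_mem fun {u v} hu hv h => ?_
    rw [ge_iff_le, le_iff_std, hstd u hu, hstd v hv]
    exact h
  · rw [← proj_std m, ← hf]
    clear hf hs hL hstd
    induction L with
    | nil => rfl
    | cons w L ih => rw [List.map_cons, List.prod_cons, ih, List.flatten_cons, proj_append]

end Std

end TraceMonoid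

/-! ### Leading terms and the sorted basis of `U`. -/

namespace TraceMonoid

open scoped TensorProduct

noncomputable section

variable {V : Type*} {Γ : SimpleGraph V}

/-- The elements of `U` supported on a set of elements of `M`. -/
abbrev supp (A : Set (TraceMonoid Γ)) : Submodule ℤ (U Γ) := MonoidAlgebra.supported ℤ ℤ A

theorem supp_eq_span (A : Set (TraceMonoid Γ)) :
    supp A = Submodule.span ℤ (MonoidAlgebra.of ℤ (TraceMonoid Γ) '' A) :=
  MonoidAlgebra.supported_eq_span_single ℤ A

theorem of_mem_supp {A : Set (TraceMonoid Γ)} {m : TraceMonoid Γ} (h : m ∈ A) :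
    MonoidAlgebra.of ℤ (TraceMonoid Γ) m ∈ supp A := by
  rw [supp_eq_span]
  exact Submodule.subset_span ⟨m, h, rfl⟩

theorem mul_mem_supp {A B C : Set (TraceMonoid Γ)} (h : ∀ a ∈ A, ∀ b ∈ B, a * b ∈ C)
    {f g : U Γ} (hf : f ∈ supp A) (hg : g ∈ supp B) : f * g ∈ supp C := by
  rw [supp_eq_span] at hf hg
  have := Submodule.mul_mem_mul hf hg
  rw [Submodule.span_mul_span] at this
  refine Submodule.span_le.2 ?_ this
  rintro _ ⟨_, ⟨a, ha, rfl⟩, _, ⟨b, hb, rfl⟩, rfl⟩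
  change _ * _ ∈ _
  rw [← map_mul]
  exact of_mem_supp (h a ha b hb)

theorem supp_length_finite [Finite V] (n : ℕ) : {m : TraceMonoid Γ | m.length = n}.Finite := by
  refine ((List.finite_length_eq V n).image (proj Γ)).subset fun m hm => ?_
  obtain ⟨w, rfl⟩ := proj_surjective Γ m
  exact ⟨w, (length_proj w).symm.trans hm, rfl⟩

section Leading

variable [LinearOrder V] [Finite V]

/-- `f` has leading term `m`: it is the sum of `m` and of larger terms of the same length. -/
def HasLeading (f : U Γ) (m : TraceMonoid Γ) : Prop :=
  f - MonoidAlgebra.of ℤ _ m ∈ supp {m' | m < m' ∧ m'.length = m.length}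

theorem hasLeading_of (m : TraceMonoid Γ) : HasLeading (MonoidAlgebra.of ℤ _ m) m := by
  simp [HasLeading]

theorem HasLeading.mem_supp {f : U Γ} {m : TraceMonoid Γ} (h : HasLeading f m) :
    f ∈ supp {m' | m ≤ m' ∧ m'.length = m.length} := by
  rw [← sub_add_cancel f (MonoidAlgebra.of ℤ _ m)]
  refine add_mem (MonoidAlgebra.supported_mono ?_ h) (of_mem_supp ⟨le_rfl, rfl⟩)
  exact fun m' hm' => ⟨hm'.1.le, hm'.2⟩

/-- Since terms have equal length, a strict inequality between left factors survives appending.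
Passing from a concatenation to the standard word of the product only increases it. -/
theorem HasLeading.mul {f g : U Γ} {x y : TraceMonoid Γ} (hf : HasLeading f x)
    (hg : HasLeading g y) (hxy : std (x * y) = std x ++ std y) : HasLeading (f * g) (x * y) := by
  have e : f * g - MonoidAlgebra.of ℤ _ (x * y) = (f - MonoidAlgebra.of ℤ _ x) * g +
      MonoidAlgebra.of ℤ _ x * (g - MonoidAlgebra.of ℤ _ y) := by
    rw [map_mul]
    noncomm_ring
  rw [HasLeading, e]
  refine add_mem (mul_mem_supp ?_ hf hg.mem_supp)
    (mul_mem_supp ?_ (of_mem_supp (Set.mem_singleton x)) hg)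
  · rintro a ⟨ha, hal⟩ b ⟨-, hbl⟩
    refine ⟨?_, by rw [length_mul, length_mul, hal, hbl]⟩
    rw [lt_iff_std, hxy]
    exact (List.append_lt_append_of_lt (lt_iff_std.1 ha) (by rw [length_std, length_std, hal])
      _ _).trans_le (std_append_le a b)
  · rintro a ha b ⟨hb, hbl⟩
    rw [Set.mem_singleton_iff.1 ha]
    refine ⟨?_, by rw [length_mul, length_mul, hbl]⟩
    rw [lt_iff_std, hxy]
    exact ((List.append_lt_append_left_iff (std x)).2 (lt_iff_std.1 hb)).trans_le
      (std_append_le x b)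

/-- All terms of `g * f` are at least `std y ++ std x`, hence above the leading term of `f * g`. -/
theorem HasLeading.lie {f g : U Γ} {x y : TraceMonoid Γ} (hf : HasLeading f x)
    (hg : HasLeading g y) (hxy : std (x * y) = std x ++ std y)
    (hlt : std x ++ std y < std y ++ std x) : HasLeading (f * g - g * f) (x * y) := by
  have h := hf.mul hg hxy
  rw [HasLeading] at h ⊢
  rw [sub_right_comm]
  refine sub_mem h (mul_mem_supp ?_ hg.mem_supp hf.mem_supp)
  rintro b ⟨hb, hbl⟩ a ⟨ha, hal⟩
  refine ⟨?_, by rw [length_mul, length_mul, hal, hbl, add_comm]⟩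
  rw [lt_iff_std, hxy]
  exact (hlt.trans_le (List.append_le_append_of_le (le_iff_std.1 hb)
    (by rw [length_std, length_std, hbl]) (le_iff_std.1 ha))).trans_le (std_append_le b a)

/-- The bracketing of an element of `M`, as an element of `U`. -/
def bracketU (m : TraceMonoid Γ) : U Γ := (bracketing (vertexL Γ) m : lieAlg Γ)

theorem bracketU_mem (m : TraceMonoid Γ) : bracketU m ∈ lieAlg Γ :=
  (bracketing (vertexL Γ) m : lieAlg Γ).2

theorem bracketU_of (x : V) : bracketU (of Γ x) = vertexU Γ x := by
  have h : ∃ i, of Γ x = of Γ i := ⟨x, rfl⟩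
  rw [bracketU, bracketing, dif_pos h, ← of_injective h.choose_spec]
  rfl

theorem length_eq_one {m : TraceMonoid Γ} (h : m.length = 1) : ∃ x, m = of Γ x := by
  rw [← length_std] at h
  obtain ⟨x, hx⟩ := List.length_eq_one_iff.1 h
  exact ⟨x, by rw [← proj_std m, hx, proj_singleton]⟩

theorem IsLyndon.bracketU_eq {m : TraceMonoid Γ} (hm : IsLyndon m) (hl : 1 < m.length) :
    ∃ x y, IsStandardFactorisation m x y ∧ std m = std x ++ std y ∧
      bracketU m = bracketU x * bracketU y - bracketU y * bracketU x := by
  obtain ⟨x, y, h, hstd, huniq⟩ := hm.exists_isStandardFactorisation hl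
  refine ⟨x, y, h, hstd, ?_⟩
  have h₁ : ¬ ∃ i, m = of Γ i := by
    rintro ⟨i, rfl⟩
    rw [length_of] at hl
    exact lt_irrefl _ hl
  have h₂ : ∃ p : TraceMonoid Γ × TraceMonoid Γ, IsStandardFactorisation m p.1 p.2 :=
    ⟨(x, y), h⟩
  -- Uniqueness of the standard factorisation identifies the pair chosen in `bracketing`.
  obtain ⟨hx, hy⟩ := huniq _ _ h₂.choose_spec
  rw [bracketU, bracketing, dif_neg h₁, dif_pos h₂, hx, hy]
  rfl

theorem IsLyndon.hasLeading {m : TraceMonoid Γ} (hm : IsLyndon m) :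
    HasLeading (bracketU m) m := by
  induction hn : m.length using Nat.strong_induction_on generalizing m with
  | _ n ih =>
    rcases (Nat.succ_le_of_lt (length_pos hm.ne_one)).eq_or_lt with hl | hl
    · obtain ⟨x, rfl⟩ := length_eq_one hl.symm
      rw [bracketU_of]
      exact hasLeading_of _
    · obtain ⟨x, y, h, hstd, e⟩ := hm.bracketU_eq hl
      have hlen : m.length = x.length + y.length := by rw [← h.mul_eq, length_mul]
      have hx := length_pos h.left.ne_one
      have hy := length_pos h.right.ne_one
      have hlt := hm.isLyndonWord.lt_rotation (mt std_eq_nil.1 h.left.ne_one)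
        (mt std_eq_nil.1 h.right.ne_one) hstd
      rw [e]
      obtain rfl := h.mul_eq
      exact (ih _ (by omega) h.left rfl).lie (ih _ (by omega) h.right rfl) hstd (hstd ▸ hlt)

theorem hasLeading_prod {l : List (TraceMonoid Γ)} (hl : ∀ m ∈ l, IsLyndon m)
    (hs : l.Pairwise (· ≥ ·)) : HasLeading (l.map bracketU).prod l.prod := by
  induction l with
  | nil => simpa [MonoidAlgebra.one_def] using hasLeading_of (1 : TraceMonoid Γ)
  | cons m l ih =>
    have hl' : ∀ n ∈ l, IsLyndon n := fun n hn => hl n (by simp [hn])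
    have hs' := (List.pairwise_cons.1 hs).2
    rw [List.map_cons, List.prod_cons, List.prod_cons]
    refine (hl m (by simp)).hasLeading.mul (ih hl' hs') ?_
    rw [← List.prod_cons, std_prod_of_pairwise hl hs, std_prod_of_pairwise hl' hs',
      List.map_cons, List.flatten_cons]

theorem HasLeading.coeff_eq_zero {f : U Γ} {m n : TraceMonoid Γ} (h : HasLeading f m)
    (hn : n < m) : f.coeff n = 0 :=
  MonoidAlgebra.mem_supported'.1 h.mem_supp n fun h' => absurd h'.1 hn.not_ge

theorem HasLeading.coeff_eq_one {f : U Γ} {m : TraceMonoid Γ} (h : HasLeading f m) :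
    f.coeff m = 1 := by
  have := MonoidAlgebra.mem_supported'.1 h m fun h' => lt_irrefl _ h'.1
  simpa [sub_eq_zero] using this

/-- In a vanishing combination, the coefficient at the smallest leading term comes from one summand
only. -/
theorem linearIndependent_of_hasLeading {ι : Type*} {b : ι → U Γ} {d : ι → TraceMonoid Γ}
    (hd : Function.Injective d) (h : ∀ i, HasLeading (b i) (d i)) : LinearIndependent ℤ b := by
  rw [linearIndependent_iff]
  intro c hc
  by_contra hne
  obtain ⟨i, hi, hmin⟩ := Finset.exists_min_image c.support d (Finsupp.support_nonempty_iff.2 hne)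
  have h0 := congrArg (fun f : U Γ => f.coeff (d i)) hc
  simp only [Finsupp.linearCombination_apply, Finsupp.sum, MonoidAlgebra.coeff_sum,
    MonoidAlgebra.coeff_smul, Finsupp.finsetSum_apply, Finsupp.smul_apply] at h0
  rw [Finset.sum_eq_single i, (h i).coeff_eq_one] at h0
  · exact Finsupp.mem_support_iff.1 hi (by simpa using h0)
  · intro j hj hji
    rw [(h j).coeff_eq_zero ((hmin j hj).lt_of_ne fun e => hji (hd e).symm), smul_zero]
  · exact fun h => absurd hi h

theorem span_eq_top_of_hasLeading {ι : Type*} {b : ι → U Γ} {d : ι → TraceMonoid Γ}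
    (hd : Function.Surjective d) (h : ∀ i, HasLeading (b i) (d i)) :
    ⊤ ≤ Submodule.span ℤ (Set.range b) := by
  have key : ∀ (n : ℕ) (m : {m : TraceMonoid Γ // m.length = n}),
      MonoidAlgebra.of ℤ (TraceMonoid Γ) m.1 ∈ Submodule.span ℤ (Set.range b) := by
    intro n m
    have : Finite {m : TraceMonoid Γ // m.length = n} := (supp_length_finite n).to_subtype
    -- Downward induction: only finitely many elements have a given length, and the error terms are
    -- larger of the same length.
    induction m using (wellFounded_gt (α := {m : TraceMonoid Γ // m.length = n})).induction with
    | _ m ih =>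
      obtain ⟨i, hi⟩ := hd m.1
      have h1 := h i
      rw [HasLeading, hi, supp_eq_span] at h1
      have h2 : Submodule.span ℤ (MonoidAlgebra.of ℤ (TraceMonoid Γ) ''
          {m' | m.1 < m' ∧ m'.length = m.1.length}) ≤ Submodule.span ℤ (Set.range b) := by
        refine Submodule.span_le.2 ?_
        rintro _ ⟨m', ⟨hlt, hlen⟩, rfl⟩
        exact ih ⟨m', hlen.trans m.2⟩ hlt
      have h3 := sub_mem (Submodule.subset_span ⟨i, rfl⟩ : b i ∈ Submodule.span ℤ (Set.range b))
        (h2 h1)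
      rwa [sub_sub_cancel] at h3
  intro f _
  have hf : f ∈ supp (Set.univ : Set (TraceMonoid Γ)) :=
    MonoidAlgebra.mem_supported'.2 fun m hm => absurd (Set.mem_univ m) hm
  rw [supp_eq_span] at hf
  refine Submodule.span_le.2 ?_ hf
  rintro _ ⟨m, -, rfl⟩
  exact key _ ⟨m, rfl⟩

end Leading

section Basis

variable [LinearOrder V] [Finite V]

/-- The product of the bracketings of a list of Lyndon elements. -/
def listProd (l : List (LyndonElement Γ)) : U Γ := (l.map fun a => bracketU a.1).prod

/-- The decreasing product of the bracketings of a multiset of Lyndon elements. -/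
def sortedProd (S : Multiset (LyndonElement Γ)) : U Γ := listProd (S.sort (· ≥ ·))

theorem sortedProd_cons {a : LyndonElement Γ} {S : Multiset (LyndonElement Γ)}
    (h : ∀ b ∈ S, b ≤ a) : sortedProd (a ::ₘ S) = bracketU a.1 * sortedProd S := by
  rw [sortedProd, Multiset.sort_cons _ _ _ h, listProd, List.map_cons, List.prod_cons]
  rfl

theorem sortedProd_zero : sortedProd (0 : Multiset (LyndonElement Γ)) = 1 := by
  simp [sortedProd, listProd]

theorem sortedProd_singleton (a : LyndonElement Γ) : sortedProd {a} = bracketU a.1 := by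
  simp [sortedProd, listProd]

/-- The decreasing product of a multiset of Lyndon elements. -/
def lead (S : Multiset (LyndonElement Γ)) : TraceMonoid Γ :=
  ((S.sort (· ≥ ·)).map Subtype.val).prod

theorem pairwise_map_sort (S : Multiset (LyndonElement Γ)) :
    ((S.sort (· ≥ ·)).map Subtype.val).Pairwise (· ≥ ·) :=
  List.pairwise_map.2 (Multiset.pairwise_sort S (· ≥ ·))

theorem isLyndon_of_mem_map {l : List (LyndonElement Γ)} :
    ∀ m ∈ l.map Subtype.val, IsLyndon m := by
  intro m hm
  obtain ⟨a, -, rfl⟩ := List.mem_map.1 hm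
  exact a.2

theorem lead_injective : Function.Injective (lead : Multiset (LyndonElement Γ) → _) := by
  intro S T h
  have := eq_of_pairwise_prod_eq isLyndon_of_mem_map (pairwise_map_sort S) isLyndon_of_mem_map
    (pairwise_map_sort T) h
  rw [← Multiset.sort_eq S (· ≥ ·), ← Multiset.sort_eq T (· ≥ ·),
    List.map_injective_iff.2 Subtype.val_injective this]

theorem lead_surjective : Function.Surjective (lead : Multiset (LyndonElement Γ) → _) := by
  intro m
  obtain ⟨l, hl, hs, rfl⟩ := exists_pairwise_prod_eq m
  lift l to List (LyndonElement Γ) using hl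
  refine ⟨l, ?_⟩
  rw [lead, Multiset.coe_sort, List.mergeSort_eq_self]
  simpa using List.pairwise_map.1 hs

theorem hasLeading_sortedProd (S : Multiset (LyndonElement Γ)) :
    HasLeading (sortedProd S) (lead S) := by
  have := hasLeading_prod isLyndon_of_mem_map (pairwise_map_sort S)
  rwa [List.map_map] at this

variable (Γ) in
/-- The basis of `U` formed by the decreasing products of bracketed Lyndon elements. -/
def sortedBasis : Module.Basis (Multiset (LyndonElement Γ)) ℤ (U Γ) :=
  Module.Basis.mk (linearIndependent_of_hasLeading lead_injective hasLeading_sortedProd)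
    (span_eq_top_of_hasLeading lead_surjective hasLeading_sortedProd)

theorem sortedBasis_apply (S : Multiset (LyndonElement Γ)) :
    sortedBasis Γ S = sortedProd S := Module.Basis.mk_apply _ _ S

end Basis

end

end TraceMonoid

/-! ### The coproduct, primitive elements and the span of the bracketings. -/

namespace TraceMonoid

open scoped TensorProduct

noncomputable section

variable {V : Type*} {Γ : SimpleGraph V}

variable (Γ) in
/-- The coproduct of `U`, for which the vertices are primitive. -/
def coproduct : U Γ →ₐ[ℤ] U Γ ⊗[ℤ] U Γ :=
  MonoidAlgebra.lift ℤ (U Γ ⊗[ℤ] U Γ) (TraceMonoid Γ)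
    (liftHom (fun x => vertexU Γ x ⊗ₜ 1 + 1 ⊗ₜ vertexU Γ x) (by
      intro x y h
      have : vertexU Γ x * vertexU Γ y = vertexU Γ y * vertexU Γ x := by
        rw [vertexU, vertexU, ← map_mul, of_comm h, map_mul]
      simp only [mul_add, add_mul, Algebra.TensorProduct.tmul_mul_tmul, one_mul, mul_one, this]
      abel))

theorem coproduct_vertexU (x : V) :
    coproduct Γ (vertexU Γ x) = vertexU Γ x ⊗ₜ 1 + 1 ⊗ₜ vertexU Γ x := by
  rw [coproduct, vertexU, MonoidAlgebra.lift_of, liftHom_of]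
  rfl

/-- Primitive elements are closed under commutators, because the mixed terms cancel. -/
theorem coproduct_of_mem_lieAlg {f : U Γ} (hf : f ∈ lieAlg Γ) :
    coproduct Γ f = f ⊗ₜ 1 + 1 ⊗ₜ f := by
  induction hf using LieSubalgebra.lieSpan_induction with
  | mem f hf =>
    obtain ⟨x, rfl⟩ := hf
    exact coproduct_vertexU x
  | zero => simp
  | add f g _ _ hf hg =>
    rw [map_add, hf, hg, TensorProduct.add_tmul, TensorProduct.tmul_add]
    abel
  | smul c f _ hf =>
    rw [map_smul, hf, smul_add, TensorProduct.smul_tmul', TensorProduct.tmul_smul]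
  | lie f g _ _ hf hg =>
    change coproduct Γ (f * g - g * f) = (f * g - g * f) ⊗ₜ 1 + 1 ⊗ₜ (f * g - g * f)
    rw [map_sub, map_mul, map_mul, hf, hg, TensorProduct.sub_tmul, TensorProduct.tmul_sub]
    simp only [mul_add, add_mul, Algebra.TensorProduct.tmul_mul_tmul, one_mul, mul_one]
    abel

theorem gradedU_eq_supp (n : ℕ) : gradedU Γ n = supp {m | m.length = n} :=
  (supp_eq_span _).symm

open Classical in
variable (Γ) in
/-- The projection of `U` to its homogeneous component of degree `n`. -/
def gradedProj (n : ℕ) : U Γ →ₗ[ℤ] U Γ :=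
  (MonoidAlgebra.basis (TraceMonoid Γ) ℤ).constr ℤ fun m =>
    if m.length = n then MonoidAlgebra.of ℤ _ m else 0

theorem gradedProj_of_mem {n k : ℕ} {f : U Γ} (hf : f ∈ gradedU Γ k) [Decidable (k = n)] :
    gradedProj Γ n f = if k = n then f else 0 := by
  have hof : ∀ m : TraceMonoid Γ, gradedProj Γ n (MonoidAlgebra.of ℤ _ m) =
      if m.length = n then MonoidAlgebra.of ℤ _ m else 0 := by
    intro m
    have := (MonoidAlgebra.basis (TraceMonoid Γ) ℤ).constr_basis ℤ
      (fun m => if m.length = n then MonoidAlgebra.of ℤ _ m else 0) m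
    rw [MonoidAlgebra.basis_apply] at this
    exact this
  induction hf using Submodule.span_induction with
  | mem f h =>
    obtain ⟨m, hm, rfl⟩ := h
    obtain rfl := hm
    exact (hof m).trans (by congr)
  | zero => simp
  | add f g _ _ hf hg => rw [map_add, hf, hg]; split <;> simp
  | smul c f _ hf => rw [map_smul, hf]; split <;> simp

variable [LinearOrder V] [Finite V]

/-- The contraction of the first tensor factor with a coordinate of the sorted basis. -/
def contract (S : Multiset (LyndonElement Γ)) : U Γ ⊗[ℤ] U Γ →ₗ[ℤ] U Γ :=
  (TensorProduct.lid ℤ (U Γ)).toLinearMap ∘ₗ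
    LinearMap.rTensor (U Γ) ((sortedBasis Γ).coord S)

theorem contract_tmul (S : Multiset (LyndonElement Γ)) (f g : U Γ) :
    contract S (f ⊗ₜ g) = (sortedBasis Γ).coord S f • g :=
  TensorProduct.lid_tmul g ((sortedBasis Γ).coord S f)

theorem coord_sortedProd (S T : Multiset (LyndonElement Γ)) [Decidable (S = T)] :
    (sortedBasis Γ).coord S (sortedProd T) = if S = T then 1 else 0 := by
  rw [← sortedBasis_apply, Module.Basis.coord_apply, Module.Basis.repr_self,
    Finsupp.single_apply]
  simp only [eq_comm]

theorem contract_one_tmul_mul (S : Multiset (LyndonElement Γ)) (f : U Γ) (t : U Γ ⊗[ℤ] U Γ) :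
    contract S ((1 ⊗ₜ f) * t) = f * contract S t := by
  induction t with
  | zero => simp
  | add t u ht hu => rw [mul_add, map_add, ht, hu, map_add, mul_add]
  | tmul g h =>
    rw [Algebra.TensorProduct.tmul_mul_tmul, contract_tmul, contract_tmul, one_mul, mul_smul_comm]

/-- The tensors whose first factors are decreasing products of Lyndon elements at most `a`. -/
def boundedTensors (a : LyndonElement Γ) : Submodule ℤ (U Γ ⊗[ℤ] U Γ) :=
  Submodule.span ℤ {t | ∃ S : Multiset (LyndonElement Γ), (∀ b ∈ S, b ≤ a) ∧
    ∃ g, t = sortedProd S ⊗ₜ g}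

theorem boundedTensors_mono {a b : LyndonElement Γ} (h : a ≤ b) :
    boundedTensors a ≤ boundedTensors b := by
  refine Submodule.span_mono ?_
  rintro _ ⟨S, hS, g, rfl⟩
  exact ⟨S, fun c hc => (hS c hc).trans h, g, rfl⟩

theorem mul_mem_boundedTensors {a : LyndonElement Γ} {t : U Γ ⊗[ℤ] U Γ}
    (ht : t ∈ boundedTensors a) :
    (bracketU a.1 ⊗ₜ 1 + 1 ⊗ₜ bracketU a.1) * t ∈ boundedTensors a := by
  induction ht using Submodule.span_induction with
  | mem t h =>
    obtain ⟨S, hS, g, rfl⟩ := h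
    rw [add_mul, Algebra.TensorProduct.tmul_mul_tmul, Algebra.TensorProduct.tmul_mul_tmul,
      ← sortedProd_cons hS, one_mul, one_mul]
    refine add_mem (Submodule.subset_span ⟨_, ?_, _, rfl⟩) (Submodule.subset_span ⟨S, hS, _, rfl⟩)
    simpa using hS
  | zero => simp
  | add t u _ _ ht hu => rw [mul_add]; exact add_mem ht hu
  | smul c t _ ht => rw [mul_smul_comm]; exact Submodule.smul_mem _ c ht

/-- For factors at most `a`, left multiplication by the bracketing of `a` just adds `a` to the index
in the sorted basis, without reordering. -/
theorem contract_bracketU_tmul_mul {a : LyndonElement Γ} {t : U Γ ⊗[ℤ] U Γ}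
    (ht : t ∈ boundedTensors a) (S : Multiset (LyndonElement Γ)) :
    contract (a ::ₘ S) ((bracketU a.1 ⊗ₜ 1) * t) = contract S t := by
  classical
  induction ht using Submodule.span_induction with
  | mem t h =>
    obtain ⟨T, hT, g, rfl⟩ := h
    rw [Algebra.TensorProduct.tmul_mul_tmul, ← sortedProd_cons hT, one_mul, contract_tmul,
      contract_tmul, coord_sortedProd, coord_sortedProd]
    simp
  | zero => simp
  | add t u _ _ ht hu => rw [mul_add, map_add, map_add, ht, hu]
  | smul c t _ ht => rw [mul_smul_comm, map_smul, map_smul, ht]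

theorem contract_bracketU_tmul_mul_of_notMem {a : LyndonElement Γ} {t : U Γ ⊗[ℤ] U Γ}
    (ht : t ∈ boundedTensors a) {S : Multiset (LyndonElement Γ)} (ha : a ∉ S) :
    contract S ((bracketU a.1 ⊗ₜ 1) * t) = 0 := by
  classical
  induction ht using Submodule.span_induction with
  | mem t h =>
    obtain ⟨T, hT, g, rfl⟩ := h
    rw [Algebra.TensorProduct.tmul_mul_tmul, ← sortedProd_cons hT, one_mul, contract_tmul,
      coord_sortedProd, if_neg, zero_smul]
    rintro rfl
    exact ha (Multiset.mem_cons_self a T)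
  | zero => simp
  | add t u _ _ ht hu => rw [mul_add, map_add, ht, hu, add_zero]
  | smul c t _ ht => rw [mul_smul_comm, map_smul, ht, smul_zero]

theorem coproduct_bracketU (m : TraceMonoid Γ) :
    coproduct Γ (bracketU m) = bracketU m ⊗ₜ 1 + 1 ⊗ₜ bracketU m :=
  coproduct_of_mem_lieAlg (bracketU_mem m)

/-- Induction over multisets by adding elements in increasing order. -/
theorem multiset_induction_max {α : Type*} [LinearOrder α] {p : Multiset α → Prop} (zero : p 0)
    (cons : ∀ a S, (∀ b ∈ S, b ≤ a) → p S → p (a ::ₘ S)) (S : Multiset α) : p S := by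
  rw [← Multiset.sort_eq S (· ≥ ·)]
  have hs := Multiset.pairwise_sort S (· ≥ ·)
  generalize S.sort (· ≥ ·) = l at hs
  induction l with
  | nil => exact zero
  | cons a l ih =>
    rw [← Multiset.cons_coe]
    obtain ⟨h1, h2⟩ := List.pairwise_cons.1 hs
    exact cons a l h1 (ih h2)

theorem coproduct_sortedProd_mem {a : LyndonElement Γ} {S : Multiset (LyndonElement Γ)}
    (h : ∀ b ∈ S, b ≤ a) : coproduct Γ (sortedProd S) ∈ boundedTensors a := by
  induction S using multiset_induction_max generalizing a with
  | zero =>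
    rw [sortedProd_zero, map_one]
    exact Submodule.subset_span ⟨0, by simp, 1, by rw [sortedProd_zero]; rfl⟩
  | cons b S hS ih =>
    rw [sortedProd_cons hS, map_mul, coproduct_bracketU]
    exact boundedTensors_mono (h b (by simp)) (mul_mem_boundedTensors (ih hS))

/-- This is the counit axiom: the coordinate at the empty multiset plays the role of the counit. -/
theorem contract_zero_coproduct (f : U Γ) : contract 0 (coproduct Γ f) = f := by
  suffices h : contract 0 ∘ₗ (coproduct Γ).toLinearMap = LinearMap.id from
    LinearMap.congr_fun h f
  refine (sortedBasis Γ).ext fun S => ?_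
  change contract 0 (coproduct Γ (sortedBasis Γ S)) = sortedBasis Γ S
  rw [sortedBasis_apply]
  induction S using multiset_induction_max with
  | zero =>
    rw [sortedProd_zero, map_one, Algebra.TensorProduct.one_def, contract_tmul]
    classical
    rw [← sortedProd_zero, coord_sortedProd, if_pos rfl, one_smul]
  | cons a S hS ih =>
    rw [sortedProd_cons hS, map_mul, coproduct_bracketU, add_mul, map_add,
      contract_bracketU_tmul_mul_of_notMem (coproduct_sortedProd_mem hS) (Multiset.notMem_zero a),
      contract_one_tmul_mul, ih, zero_add]

/-- The contraction with a Lyndon element acts on the sorted basis like a partial derivative. -/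
theorem contract_coproduct_sortedProd (y : LyndonElement Γ) (S : Multiset (LyndonElement Γ)) :
    contract {y} (coproduct Γ (sortedProd S)) = S.count y • sortedProd (S.erase y) := by
  induction S using multiset_induction_max with
  | zero =>
    rw [sortedProd_zero, map_one, Algebra.TensorProduct.one_def, contract_tmul,
      ← sortedProd_zero, coord_sortedProd, if_neg (Multiset.singleton_ne_zero y)]
    simp
  | cons a S hS ih =>
    rw [sortedProd_cons hS, map_mul, coproduct_bracketU, add_mul, map_add,
      contract_one_tmul_mul, ih]
    have herase : ∀ b ∈ S.erase y, b ≤ a := fun b hb => hS b (Multiset.mem_of_mem_erase hb)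
    rw [mul_smul_comm, ← sortedProd_cons herase]
    have hmem := coproduct_sortedProd_mem hS
    rcases eq_or_ne a y with rfl | hay
    · have h1 := contract_bracketU_tmul_mul hmem 0
      rw [Multiset.cons_zero] at h1
      rw [h1, contract_zero_coproduct, Multiset.count_cons_self, Multiset.erase_cons_head,
        add_smul, one_smul, add_comm]
      by_cases haS : a ∈ S
      · rw [Multiset.cons_erase haS]
      · rw [Multiset.count_eq_zero_of_notMem haS, zero_smul, zero_smul]
    · rw [contract_bracketU_tmul_mul_of_notMem hmem (by simpa using hay), zero_add,
        Multiset.count_cons_of_ne hay.symm, Multiset.erase_cons_tail _ hay]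

/-- The derivative formula read on coordinates: the multiplicity of `y` in `y ::ₘ T` is `T.count y +
1`. -/
theorem coord_contract_coproduct (y : LyndonElement Γ) (T : Multiset (LyndonElement Γ))
    (f : U Γ) :
    (sortedBasis Γ).coord T (contract {y} (coproduct Γ f)) =
      (T.count y + 1) • (sortedBasis Γ).coord (y ::ₘ T) f := by
  suffices h : (sortedBasis Γ).coord T ∘ₗ contract {y} ∘ₗ (coproduct Γ).toLinearMap =
      (T.count y + 1) • (sortedBasis Γ).coord (y ::ₘ T) from LinearMap.congr_fun h f
  refine (sortedBasis Γ).ext fun S => ?_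
  change (sortedBasis Γ).coord T (contract {y} (coproduct Γ (sortedBasis Γ S))) =
    (T.count y + 1) • (sortedBasis Γ).coord (y ::ₘ T) (sortedBasis Γ S)
  rw [sortedBasis_apply, contract_coproduct_sortedProd, map_nsmul, coord_sortedProd,
    coord_sortedProd]
  by_cases hy : y ∈ S
  · obtain ⟨S, rfl⟩ := Multiset.exists_cons_of_mem hy
    rw [Multiset.erase_cons_head, Multiset.count_cons_self]
    by_cases h : T = S
    · subst h
      simp
    · simp [h]
  · rw [Multiset.count_eq_zero_of_notMem hy, zero_smul, if_neg, smul_zero]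
    rintro rfl
    exact hy (Multiset.mem_cons_self y T)

/-- For primitive `f` the derivative by `y` is a multiple of `1`, so its coordinate at a nonempty
`T` vanishes. The empty multiset is handled by the counit identity. -/
theorem coord_eq_zero_of_mem_lieAlg {f : U Γ} (hf : f ∈ lieAlg Γ)
    {S : Multiset (LyndonElement Γ)} (hS : ∀ a, S ≠ {a}) : (sortedBasis Γ).coord S f = 0 := by
  have hone : ∀ S : Multiset (LyndonElement Γ), (sortedBasis Γ).coord S 1 = if S = 0 then 1 else 0 :=
    fun S => by rw [← sortedProd_zero, coord_sortedProd]
  have hcop := coproduct_of_mem_lieAlg hf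
  rcases S.empty_or_exists_mem with rfl | ⟨y, hy⟩
  · have h := contract_zero_coproduct f
    rw [hcop, map_add, contract_tmul, contract_tmul, hone, if_pos rfl, one_smul,
      add_eq_right] at h
    have h1 := congrArg ((sortedBasis Γ).coord 0) h
    rw [map_smul, hone, if_pos rfl, map_zero] at h1
    simpa using h1
  · obtain ⟨T, rfl⟩ := Multiset.exists_cons_of_mem hy
    have hT : T ≠ 0 := by
      rintro rfl
      exact hS y rfl
    have h := coord_contract_coproduct y T f
    rw [hcop, map_add, contract_tmul, contract_tmul, hone, if_neg (Multiset.singleton_ne_zero y),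
      zero_smul, add_zero, map_smul, hone, if_neg hT, smul_zero] at h
    -- The positive factor `T.count y + 1` cancels because `ℤ` has no torsion.
    rw [eq_comm, smul_eq_zero] at h
    exact h.resolve_left (Nat.succ_ne_zero _)

theorem mem_span_bracketU {f : U Γ} (hf : f ∈ lieAlg Γ) :
    f ∈ Submodule.span ℤ (Set.range fun a : LyndonElement Γ => bracketU a.1) := by
  rw [← (sortedBasis Γ).linearCombination_repr f, Finsupp.linearCombination_apply]
  refine Submodule.sum_mem _ fun S hS => Submodule.smul_mem _ _ ?_
  by_cases h : ∃ a, S = {a}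
  · obtain ⟨a, rfl⟩ := h
    rw [sortedBasis_apply, sortedProd_singleton]
    exact Submodule.subset_span ⟨a, rfl⟩
  · push Not at h
    exact absurd (coord_eq_zero_of_mem_lieAlg hf h) (Finsupp.mem_support_iff.1 hS)

theorem linearIndependent_bracketU :
    LinearIndependent ℤ fun a : LyndonElement Γ => bracketU a.1 :=
  linearIndependent_of_hasLeading Subtype.val_injective fun a => a.2.hasLeading

theorem coe_ell (c : LyndonElement Γ →₀ ℤ) :
    (ell Γ c : U Γ) =
      Finsupp.linearCombination ℤ (fun a : LyndonElement Γ => bracketU a.1) c := by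
  rw [ell, phi, Finsupp.linearCombination_apply, Finsupp.linearCombination_apply, Finsupp.sum,
    Finsupp.sum, ← LieSubalgebra.coe_incl, map_sum]
  rfl

theorem ell_bijective : Function.Bijective (ell Γ) := by
  constructor
  · intro c d h
    have := congrArg (fun f : lieAlg Γ => (f : U Γ)) h
    simp only [coe_ell] at this
    exact linearIndependent_bracketU this
  · rintro ⟨f, hf⟩
    obtain ⟨c, hc⟩ := Finsupp.mem_span_range_iff_exists_finsupp.1 (mem_span_bracketU hf)
    exact ⟨c, Subtype.ext ((coe_ell c).trans hc)⟩

theorem bracketU_mem_supp (a : LyndonElement Γ) :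
    bracketU a.1 ∈ supp {m : TraceMonoid Γ | m.length = a.1.length} :=
  MonoidAlgebra.supported_mono (fun _ h => h.2) a.2.hasLeading.mem_supp

/-- The projection to degree `n` fixes `f` and keeps or kills each homogeneous bracketing in an
expansion of `f`. -/
theorem mem_span_bracketU_of_mem_gradedLieAlg {n : ℕ} {f : U Γ} (hf : f ∈ gradedLieAlg Γ n) :
    f ∈ Submodule.span ℤ
      (Set.range fun a : {a : LyndonElement Γ // a.1.length = n} => bracketU a.1.1) := by
  classical
  have h : gradedProj Γ n f = f := by rw [gradedProj_of_mem hf.2, if_pos rfl]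
  rw [← h]
  have key : Submodule.span ℤ (Set.range fun a : LyndonElement Γ => bracketU a.1) ≤
      Submodule.comap (gradedProj Γ n) (Submodule.span ℤ
        (Set.range fun a : {a : LyndonElement Γ // a.1.length = n} => bracketU a.1.1)) := by
    refine Submodule.span_le.2 ?_
    rintro _ ⟨a, rfl⟩
    rw [SetLike.mem_coe, Submodule.mem_comap]
    rw [gradedProj_of_mem (gradedU_eq_supp (Γ := Γ) _ ▸ bracketU_mem_supp a)]
    split
    · next ha => exact Submodule.subset_span ⟨⟨a, ha⟩, rfl⟩
    · exact zero_mem _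
  exact key (mem_span_bracketU hf.1)

theorem bracketU_mem_gradedLieAlg {n : ℕ} (a : {a : LyndonElement Γ // a.1.length = n}) :
    bracketU a.1.1 ∈ gradedLieAlg Γ n := by
  refine ⟨bracketU_mem _, ?_⟩
  obtain ⟨a, rfl⟩ := a
  rw [gradedU_eq_supp]
  exact bracketU_mem_supp a

end

end TraceMonoid

theorem mainTheorem4 {V : Type*} [LinearOrder V] [Finite V] (Γ : SimpleGraph V) :
    Function.Bijective (TraceMonoid.ell Γ) ∧
    (∃ b : Module.Basis (TraceMonoid.LyndonElement Γ) ℤ (TraceMonoid.lieAlg Γ),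
      ∀ a : TraceMonoid.LyndonElement Γ, b a = TraceMonoid.bracketing (TraceMonoid.vertexL Γ) a.1) ∧
    (∀ n : ℕ, Finite {a : TraceMonoid.LyndonElement Γ // a.1.length = n} ∧
      ∃ b : Module.Basis {a : TraceMonoid.LyndonElement Γ // a.1.length = n} ℤ
          (TraceMonoid.gradedLieAlg Γ n),
        ∀ a, (b a : TraceMonoid.U Γ) =
          (TraceMonoid.bracketing (TraceMonoid.vertexL Γ) a.1.1 : TraceMonoid.lieAlg Γ)) := by
  refine ⟨TraceMonoid.ell_bijective,
    ⟨.ofRepr (LinearEquiv.ofBijective _ TraceMonoid.ell_bijective).symm, fun a => ?_⟩,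
    fun n => ⟨?_, ?_⟩⟩
  · change TraceMonoid.ell Γ (Finsupp.single a 1) = _
    rw [TraceMonoid.ell, TraceMonoid.phi, Finsupp.linearCombination_single, one_smul]
  · have := (TraceMonoid.supp_length_finite (Γ := Γ) n).to_subtype
    exact Finite.of_injective
      (fun a : {a : TraceMonoid.LyndonElement Γ // a.1.length = n} =>
        (⟨a.1.1, a.2⟩ : {m : TraceMonoid Γ | m.length = n}))
      fun a b h => Subtype.ext (Subtype.ext (congrArg (fun m => m.1) h))
  · let v : {a : TraceMonoid.LyndonElement Γ // a.1.length = n} → TraceMonoid.gradedLieAlg Γ n :=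
      fun a => ⟨TraceMonoid.bracketU a.1.1, TraceMonoid.bracketU_mem_gradedLieAlg a⟩
    have hli : LinearIndependent ℤ v := by
      refine LinearIndependent.of_comp (TraceMonoid.gradedLieAlg Γ n).subtype ?_
      exact TraceMonoid.linearIndependent_bracketU.comp _ Subtype.val_injective
    refine ⟨.mk hli ?_, fun a => ?_⟩
    · rintro ⟨f, hf⟩ -
      have h := TraceMonoid.mem_span_bracketU_of_mem_gradedLieAlg hf
      obtain ⟨c, hc⟩ := Finsupp.mem_span_range_iff_exists_finsupp.1 h
      refine Finsupp.mem_span_range_iff_exists_finsupp.2 ⟨c, Subtype.ext (Eq.trans ?_ hc)⟩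
      rw [Finsupp.sum, Finsupp.sum, ← Submodule.subtype_apply, map_sum]
      rfl
    · rw [Module.Basis.mk_apply]
      rfl
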